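/- All graphs are simple; $d_X$ is the path metric of a graph $X$. A connected graph $X$ is hyperbolic if for some $\delta\ge 0$, in every triangle of shortest paths every vertex of one side has distance at most $\delta$ to a vertex of another side. Two geodesic rays are equivalent if for some $M$ each contains infinitely many vertices of distance at most $M$ to the other; the classes form the hyperbolic boundary $\partial X$. It carries the topology in which $O\subseteq\partial X$ is open iff for every $\xi\in O$ there is $n$ such that $O$ contains every $\eta$ for which there are geodesic rays $r\in\xi$, $s\in\eta$ with Gromov products $(r_i\,|\,s_j)_o\ge n$ for all large $i,j$ ($o$ a base vertex, whose choice is irrelevant). A vertex sequence $(x_i)$ converges to $\eta\in\partial X$ if there are a geodesic ray $y_0y_1\ldots$ in $\eta$ and $n_i\to\infty$ such that every geodesic path from $x_i$ to $y_i$ has distance at least $n_i$ to $o$. A graph is quasi-transitive if its automorphism group has finitely many orbits on the vertices. Let $G$ and $H$ be connected, locally finite, hyperbolic, quasi-transitive graphs. Let $p,q\in\mathbb N\cup\{\infty\}$ and let $T$ be a $(p,q)$-semiregular tree with bipartition $\{U,V\}$ (all vertices in $U$ have degree $p$, all in $V$ have degree $q$). Let $S_k\subseteq V(G)$ $(0\le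 k<p)$ and $S'_\ell\subseteq V(H)$ $(0\le \ell<q)$ be non-empty sets (the adhesion sets) with $\sup_k \operatorname{diam}_G S_k<\infty$ and $\sup_\ell\operatorname{diam}_H S'_\ell<\infty$, let $\varphi_{k,\ell}\colon S_k\to S'_\ell$ be bijections, and let $c\colon E(T)\to\{(k,\ell)\mid 0\le k<p,\ 0\le\ell<q\}$ be such that at every $u\in U$ all first coordinates $k$, and at every $v\in V$ all second coordinates $\ell$, occur on the edges incident with that vertex. Let $G+_TH$ be the graph obtained from the disjoint union of copies $G^u$ of $G$ $(u\in U)$ and $H^v$ of $H$ $(v\in V)$ by adding, for every edge $uv$ of $T$ with $u\in U$, $v\in V$ and $c(uv)=(k,\ell)$ and every $x\in S_k$, an edge between the copy of $x$ in $G^u$ and the copy of $\varphi_{k,\ell}(x)$ in $H^v$. Then $G+_TH$ is connected and hyperbolic, and there is a bijection from the disjoint union $$f\colon\ \partial T\ \cup\ \bigcup_{u\in U}\partial G^u\ \cup\ \bigcup_{v\in V}\partial H^v\ \longrightarrow\ \partial(G+_TH)$$ such that: 1. the preimage under $f$ of each connected component of $\partial(G+_TH)$ is a connected component of $\partial T$,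 of some $\partial G^u$ or of some $\partial H^v$; 2. every sequence of vertices in some $G^u$ or $H^v$ that converges there to a boundary point $\eta$ of $G^u$ or $H^v$ converges to $f(\eta)$ in $G+_TH$; 3. every sequence $(z_i)$ of vertices with $z_i$ in $G^{t_i}$ or $H^{t_i}$, where $(t_i)$ converges in $T$ to some $\eta\in\partial T$, converges to $f(\eta)$ in $G+_TH$. Moreover $f$ is canonical: it is the only map between these sets that satisfies 2 and 3. -/

import Mathlib

noncomputable section

namespace TreeAmalgam

/-! ### Hyperbolic graphs and their boundaries -/

section Hyperbolic

variable {X : Type*}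

/-- Every vertex has finitely many neighbours. -/
def IsLocallyFinite (G : SimpleGraph X) : Prop :=
  ∀ x, (G.neighborSet x).Finite

/-- The automorphism group has only finitely many orbits on the vertex set. -/
def IsQuasiTransitive (G : SimpleGraph X) : Prop :=
  ∃ F : Set X, F.Finite ∧ ∀ x, ∃ y ∈ F, ∃ a : G ≃g G, a y = x

/-- A walk is a shortest path between its end vertices. -/
def IsShortest {G : SimpleGraph X} {x y : X} (P : G.Walk x y) : Prop :=
  P.length = G.dist x y

/-- Geodesic triangles are `δ`-thin: every vertex of one side has distance at most `δ` to a vertex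
on one of the two other sides. -/
def IsDeltaHyperbolic (G : SimpleGraph X) (δ : ℝ) : Prop :=
  ∀ (x y z : X) (P₁ : G.Walk x y) (P₂ : G.Walk y z) (P₃ : G.Walk x z),
    IsShortest P₁ → IsShortest P₂ → IsShortest P₃ →
      ∀ a ∈ P₁.support, ∃ b, (b ∈ P₂.support ∨ b ∈ P₃.support) ∧ (G.dist a b : ℝ) ≤ δ

def IsHyperbolic (G : SimpleGraph X) : Prop :=
  ∃ δ : ℝ, 0 ≤ δ ∧ IsDeltaHyperbolic G δ

/-- Geodesic rays, given by the sequence of their vertices.  Consecutive vertices have distance 1,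
that is, they are adjacent. -/
structure GeodesicRay (G : SimpleGraph X) where
  vertex : ℕ → X
  geodesic : ∀ i k : ℕ, G.dist (vertex i) (vertex (i + k)) = k

/-- Two geodesic rays are equivalent if, for some `M`, on each of them there are infinitely many
vertices of distance at most `M` to the other one. -/
def GeodesicRay.Equivalent {G : SimpleGraph X} (r s : GeodesicRay G) : Prop :=
  ∃ M : ℕ, {i | ∃ j, G.dist (r.vertex i) (s.vertex j) ≤ M}.Infinite ∧
    {j | ∃ i, G.dist (s.vertex j) (r.vertex i) ≤ M}.Infinite

/-- The hyperbolic boundary: geodesic rays up to equivalence. -/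
def Boundary (G : SimpleGraph X) : Type _ :=
  Quot (GeodesicRay.Equivalent (G := G))

/-- The boundary point that contains a given geodesic ray. -/
def GeodesicRay.point {G : SimpleGraph X} (r : GeodesicRay G) : Boundary G :=
  Quot.mk _ r

/-- The sequence `x` of vertices converges to the boundary point `η`: for some geodesic ray
`y 0, y 1, …` in `η`, the distance of a base vertex `o` to all geodesic paths from `x i` to `y i`
is bounded below by a sequence that goes to infinity. -/
def ConvergesTo (G : SimpleGraph X) (x : ℕ → X) (η : Boundary G) : Prop :=
  ∃ y : GeodesicRay G, y.point = η ∧ ∀ o : X, ∃ n : ℕ → ℕ,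
    Filter.Tendsto n Filter.atTop Filter.atTop ∧
      ∀ (i : ℕ) (P : G.Walk (x i) (y.vertex i)), IsShortest P →
        ∀ a ∈ P.support, n i ≤ G.dist o a

/-- The Gromov product of `x` and `y` with respect to the base vertex `o`. -/
def gromovProduct (G : SimpleGraph X) (o x y : X) : ℝ :=
  ((G.dist o x : ℝ) + G.dist o y - G.dist x y) / 2

/-- `Near G o n ξ η` says that `η` lies in the basic neighbourhood with parameter `n` of `ξ`:
there are geodesic rays `r` in `ξ` and `s` in `η` whose Gromov products `(r i | s j)` with respect
to `o` are at least `n` for all large `i` and `j`. -/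
def Near (G : SimpleGraph X) (o : X) (n : ℕ) (ξ η : Boundary G) : Prop :=
  ∃ r s : GeodesicRay G, r.point = ξ ∧ s.point = η ∧
    ∃ N : ℕ, ∀ i ≥ N, ∀ j ≥ N, (n : ℝ) ≤ gromovProduct G o (r.vertex i) (s.vertex j)

theorem Near.mono {G : SimpleGraph X} {o : X} {m n : ℕ} (hmn : m ≤ n) {ξ η : Boundary G}
    (h : Near G o n ξ η) : Near G o m ξ η := by
  obtain ⟨r, s, hr, hs, N, hN⟩ := h
  exact ⟨r, s, hr, hs, N, fun i hi j hj => le_trans (Nat.cast_le.mpr hmn) (hN i hi j hj)⟩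

/-- The usual topology on the hyperbolic boundary: a set is open if it contains a basic
neighbourhood of each of its points.  (For connected graphs the choice of the base vertex `o` makes
no difference.) -/
instance (G : SimpleGraph X) : TopologicalSpace (Boundary G) where
  IsOpen O := ∀ ξ ∈ O, ∀ o : X, ∃ n : ℕ, ∀ η, Near G o n ξ η → η ∈ O
  isOpen_univ := fun _ _ _ => ⟨0, fun _ _ => trivial⟩
  isOpen_inter := by
    intro A B hA hB ξ hξ o
    obtain ⟨m, hm⟩ := hA ξ hξ.1 o
    obtain ⟨n, hn⟩ := hB ξ hξ.2 o
    exact ⟨max m n, fun η h =>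
      ⟨hm η (h.mono (le_max_left m n)), hn η (h.mono (le_max_right m n))⟩⟩
  isOpen_sUnion := by
    intro S hS ξ hξ o
    obtain ⟨A, hA, hξA⟩ := hξ
    obtain ⟨n, hn⟩ := hS A hA ξ hξA o
    exact ⟨n, fun η h => ⟨A, hA, hn η h⟩⟩

end Hyperbolic

/-! ### Amalgamating two graphs along a semiregular tree -/

/-- `T` is a `(p, q)`-semiregular tree with canonical bipartition `U`, `V` of its vertex set. -/
structure IsSemiregularTree {W : Type*} (T : SimpleGraph W) (U V : Set W) (p q : ℕ∞) : Prop where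
  isTree : T.IsTree
  bipartite : T.IsBipartiteWith U V
  cover : U ∪ V = Set.univ
  degree_left : ∀ u ∈ U, (T.neighborSet u).encard = p
  degree_right : ∀ v ∈ V, (T.neighborSet v).encard = q

/-- The labels `0 ≤ k < p`, where `p` may be infinite. -/
abbrev Label (p : ℕ∞) : Type := {k : ℕ // (k : ℕ∞) < p}

/-- The data by which copies of two graphs with vertex sets `A` and `B` are glued along the tree
`T`: (non-empty) adhesion sets in both graphs, a bijection between any adhesion set of the first
and any of the second graph (in particular all adhesion sets have the same size), and a labelling
of the edges of `T` by pairs of labels such that at every vertex of `U` all first labels and at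
every vertex of `V` all second labels occur. -/
structure Gluing (A B : Type*) {W : Type*} (T : SimpleGraph W) (U V : Set W) (p q : ℕ∞) where
  adhesionLeft : Label p → Set A
  adhesionRight : Label q → Set B
  nonempty_left : ∀ k, (adhesionLeft k).Nonempty
  nonempty_right : ∀ l, (adhesionRight l).Nonempty
  identify : ∀ k l, adhesionLeft k ≃ adhesionRight l
  label : T.edgeSet → Label p × Label q
  exhaust_left : ∀ u ∈ U, ∀ k, ∃ e : T.edgeSet, u ∈ (e : Sym2 W) ∧ (label e).1 = k
  exhaust_right : ∀ v ∈ V, ∀ l, ∃ e : T.edgeSet, v ∈ (e : Sym2 W) ∧ (label e).2 = l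

section Amalgam

variable {A B W : Type*} {T : SimpleGraph W} {U V : Set W} {p q : ℕ∞}

/-- Bounded adhesion: the diameters of the adhesion sets are bounded. -/
def Gluing.BoundedAdhesion (D : Gluing A B T U V p q) (G : SimpleGraph A) (H : SimpleGraph B) :
    Prop :=
  ∃ N : ℕ, (∀ k, ∀ x ∈ D.adhesionLeft k, ∀ y ∈ D.adhesionLeft k, G.dist x y ≤ N) ∧
    (∀ l, ∀ x ∈ D.adhesionRight l, ∀ y ∈ D.adhesionRight l, H.dist x y ≤ N)

/-- The vertices of the disjoint union of the copies `G^u`, `u ∈ U`, of `G` and `H^v`, `v ∈ V`,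
of `H`. -/
abbrev Vertex (A B : Type*) {W : Type*} (U V : Set W) : Type _ := (U × A) ⊕ (V × B)

/-- The vertex `t` of the tree such that the given vertex lies in `G^t` or `H^t`. -/
def treeVertex : Vertex A B U V → W
  | .inl z => z.1
  | .inr z => z.1

/-- The vertex `x` of `G^u` and the vertex `y` of `H^v` are joined by a new edge: `uv` is an edge
of the tree, with label `(k, l)` say, and `y` is the image of `x` under the bijection from the
`k`-th adhesion set of `G` to the `l`-th adhesion set of `H`. -/
def Gluing.NewEdge (D : Gluing A B T U V p q) (u : U) (x : A) (v : V) (y : B) : Prop :=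
  ∃ (e : T.Adj u v)
    (hx : x ∈ D.adhesionLeft (D.label ⟨s((u : W), (v : W)), e⟩).1),
      (D.identify _ (D.label ⟨s((u : W), (v : W)), e⟩).2 ⟨x, hx⟩ : B) = y

/-- The graph `G +_T H`: the disjoint union of all `G^u` and `H^v` together with the new edges. -/
def Gluing.sumGraph (D : Gluing A B T U V p q) (G : SimpleGraph A) (H : SimpleGraph B) :
    SimpleGraph (Vertex A B U V) where
  Adj
    | .inl (u, x), .inl (u', x') => u = u' ∧ G.Adj x x'
    | .inr (v, y), .inr (v', y') => v = v' ∧ H.Adj y y'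
    | .inl (u, x), .inr (v, y) => D.NewEdge u x v y
    | .inr (v, y), .inl (u, x) => D.NewEdge u x v y
  symm := ⟨by
    rintro (⟨u, x⟩ | ⟨v, y⟩) (⟨u', x'⟩ | ⟨v', y'⟩) h
    · exact ⟨h.1.symm, h.2.symm⟩
    · exact h
    · exact h
    · exact ⟨h.1.symm, h.2.symm⟩⟩
  loopless := ⟨by
    rintro (⟨u, x⟩ | ⟨v, y⟩) h
    · exact G.irrefl h.2
    · exact H.irrefl h.2⟩

/-- The disjoint union of `∂T`, all `∂G^u` for `u ∈ U`, and all `∂H^v` for `v ∈ V`, where `G^u` and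
`H^v` are copies of `G` and `H`. -/
abbrev PieceBoundary (T : SimpleGraph W) (U V : Set W) (G : SimpleGraph A) (H : SimpleGraph B) :
    Type _ :=
  Boundary T ⊕ (U × Boundary G) ⊕ (V × Boundary H)

variable {G : SimpleGraph A} {H : SimpleGraph B}

/-- The copy in `PieceBoundary` of a boundary point of `T`. -/
def ofTree (U V : Set W) (G : SimpleGraph A) (H : SimpleGraph B) (η : Boundary T) :
    PieceBoundary T U V G H := .inl η

/-- The copy in `∂G^u` of a boundary point of `G`. -/
def ofLeft (T : SimpleGraph W) (V : Set W) (H : SimpleGraph B) (u : U) (η : Boundary G) :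
    PieceBoundary T U V G H := .inr (.inl (u, η))

/-- The copy in `∂H^v` of a boundary point of `H`. -/
def ofRight (T : SimpleGraph W) (U : Set W) (G : SimpleGraph A) (v : V) (η : Boundary H) :
    PieceBoundary T U V G H := .inr (.inr (v, η))

/-- The preimage under `f` of every connected component of `∂(G +_T H)` is a connected component of
`∂T`, of some `∂G^u` or of some `∂H^v`. -/
def ComponentsPullBack (D : Gluing A B T U V p q)
    (f : PieceBoundary T U V G H → Boundary (D.sumGraph G H)) : Prop :=
  ∀ ξ : Boundary (D.sumGraph G H),
    (∃ η : Boundary T, f ⁻¹' connectedComponent ξ = ofTree U V G H '' connectedComponent η) ∨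
    (∃ (u : U) (η : Boundary G),
      f ⁻¹' connectedComponent ξ = ofLeft T V H u '' connectedComponent η) ∨
    (∃ (v : V) (η : Boundary H),
      f ⁻¹' connectedComponent ξ = ofRight T U G v '' connectedComponent η)

/-- Every sequence in some `G^u` or `H^v` that converges there to a boundary point `η` converges to
`f η` in `G +_T H`. -/
def RespectsPieces (D : Gluing A B T U V p q)
    (f : PieceBoundary T U V G H → Boundary (D.sumGraph G H)) : Prop :=
  (∀ (u : U) (x : ℕ → A) (η : Boundary G), ConvergesTo G x η →
    ConvergesTo (D.sumGraph G H) (fun i => .inl (u, x i)) (f (ofLeft T V H u η))) ∧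
  (∀ (v : V) (y : ℕ → B) (η : Boundary H), ConvergesTo H y η →
    ConvergesTo (D.sumGraph G H) (fun i => .inr (v, y i)) (f (ofRight T U G v η)))

/-- Every sequence of vertices `z i` in `G^(t i)` or `H^(t i)` such that `t` converges to a boundary
point `η` of `T` converges to `f η` in `G +_T H`. -/
def RespectsTree (D : Gluing A B T U V p q)
    (f : PieceBoundary T U V G H → Boundary (D.sumGraph G H)) : Prop :=
  ∀ (z : ℕ → Vertex A B U V) (η : Boundary T), ConvergesTo T (fun i => treeVertex (z i)) η →
    ConvergesTo (D.sumGraph G H) z (f (ofTree U V G H η))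

end Amalgam

end TreeAmalgam

end

/-!
The projection `treeVertex` arranges `G +_T H` along `T`, and since the adhesion is bounded, all new
edges that belong to the same edge of `T` lie close together. Choose one new edge for every edge of
`T` and join two vertices of `G +_T H` by shortest paths inside the copies between the chosen edges
on the way. Any three vertices have a centre in `T`. Outside the copy over this centre their three
connections coincide in pairs, and inside it they form a triangle of shortest paths, which is thin.
By the guessing geodesics criterion such a system of connections makes `G +_T H` hyperbolic.

Gromov products in a copy, and those of the projections to `T`, are bounded linearly by Gromov
products in `G +_T H`. So the inclusion of a copy and every section of the projection to `T`
preserve the convergence of sequences to a common boundary point, and they induce maps from the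
boundaries of the copies and of `T` to that of `G +_T H`. These maps reach every boundary point: a
geodesic ray either meets one copy infinitely often, and then some ray of that locally finite copy
has the same limit, or its projection goes to an end of `T`. Finally, Gromov products across an
edge of `T` are bounded, so every edge splits the boundary into two clopen sets. These sets
separate the boundaries of the copies and the ends of `T` from each other, so that no connected set
meets two of them.
-/

open Filter

namespace TreeAmalgam

/-! ### Intervals and Gromov products -/

section Metric

variable {X : Type*} {Γ : SimpleGraph X}

/-- The interval between two vertices: all vertices that lie on a shortest path between them. -/
def interval (Γ : SimpleGraph X) (x y : X) : Set X :=
  {w | Γ.dist x w + Γ.dist w y = Γ.dist x y}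

lemma mem_interval {x y w : X} :
    w ∈ interval Γ x y ↔ Γ.dist x w + Γ.dist w y = Γ.dist x y := Iff.rfl

lemma left_mem_interval (x y : X) : x ∈ interval Γ x y := by simp [mem_interval]

lemma right_mem_interval (x y : X) : y ∈ interval Γ x y := by simp [mem_interval]

lemma mem_interval_comm {x y w : X} : w ∈ interval Γ x y ↔ w ∈ interval Γ y x := by
  rw [mem_interval, mem_interval, Γ.dist_comm (u := x) (v := w), Γ.dist_comm (u := w) (v := y),
    Γ.dist_comm (u := x) (v := y), add_comm]

lemma mem_interval_trans (hΓ : Γ.Connected) {o v w y : X} (hv : v ∈ interval Γ o y)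
    (hw : w ∈ interval Γ v y) : w ∈ interval Γ o y ∧ v ∈ interval Γ o w := by
  simp only [mem_interval] at *
  have how := hΓ.dist_triangle (u := o) (v := v) (w := w)
  have hoy := hΓ.dist_triangle (u := o) (v := w) (w := y)
  constructor <;> omega

lemma mem_interval_of_mem_of_mem (hΓ : Γ.Connected) {o v w y : X} (hw : w ∈ interval Γ o y)
    (hv : v ∈ interval Γ o w) : v ∈ interval Γ o y := by
  simp only [mem_interval] at *
  have hvy := hΓ.dist_triangle (u := v) (v := w) (w := y)
  have hoy := hΓ.dist_triangle (u := o) (v := v) (w := y)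
  omega

lemma eq_of_mem_interval_self (hΓ : Γ.Connected) {x w : X} (hw : w ∈ interval Γ x x) : w = x := by
  rw [mem_interval, SimpleGraph.dist_self] at hw
  exact hΓ.dist_eq_zero_iff.1 (by omega)

lemma eq_or_eq_of_mem_interval_of_adj (hΓ : Γ.Connected) {x y w : X} (hxy : Γ.Adj x y)
    (hw : w ∈ interval Γ x y) : w = x ∨ w = y := by
  rw [mem_interval, SimpleGraph.dist_eq_one_iff_adj.2 hxy] at hw
  by_cases hxw : Γ.dist x w = 0
  · exact Or.inl (hΓ.dist_eq_zero_iff.1 hxw).symm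
  · exact Or.inr (hΓ.dist_eq_zero_iff.1 (by omega))

lemma cast_dist_triangle (hΓ : Γ.Connected) (x y z : X) :
    (Γ.dist x z : ℝ) ≤ Γ.dist x y + Γ.dist y z := by
  exact_mod_cast hΓ.dist_triangle

lemma cast_dist_triangle_left (hΓ : Γ.Connected) (x y z : X) :
    (Γ.dist x y : ℝ) ≤ Γ.dist z x + Γ.dist z y := by
  rw [Γ.dist_comm (u := z) (v := x)]
  exact cast_dist_triangle hΓ x z y

lemma cast_dist_triangle_right (hΓ : Γ.Connected) (x y z : X) :
    (Γ.dist x y : ℝ) ≤ Γ.dist x z + Γ.dist y z := by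
  rw [Γ.dist_comm (u := y) (v := z)]
  exact cast_dist_triangle hΓ x z y

lemma cast_dist_add_dist {x y w : X} (hw : w ∈ interval Γ x y) :
    (Γ.dist x w : ℝ) + Γ.dist w y = Γ.dist x y := by
  exact_mod_cast hw

lemma gromovProduct_self (o x : X) : gromovProduct Γ o x x = Γ.dist o x := by
  simp [gromovProduct]

lemma gromovProduct_comm (o x y : X) : gromovProduct Γ o x y = gromovProduct Γ o y x := by
  simp only [gromovProduct]
  rw [Γ.dist_comm (u := x) (v := y)]
  ring

lemma gromovProduct_nonneg (hΓ : Γ.Connected) (o x y : X) : 0 ≤ gromovProduct Γ o x y := by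
  simp only [gromovProduct]
  linarith [cast_dist_triangle_left hΓ x y o]

lemma gromovProduct_le_dist_of_mem (hΓ : Γ.Connected) {o x y w : X}
    (hw : w ∈ interval Γ x y) : gromovProduct Γ o x y ≤ Γ.dist o w := by
  simp only [gromovProduct]
  linarith [cast_dist_add_dist hw, cast_dist_triangle_right hΓ o x w, cast_dist_triangle hΓ o w y]

lemma gromovProduct_eq_dist_of_mem {o y w : X}
    (hw : w ∈ interval Γ o y) : gromovProduct Γ o w y = Γ.dist o w := by
  simp only [gromovProduct]
  linarith [cast_dist_add_dist hw]

lemma gromovProduct_le_add_dist_base (hΓ : Γ.Connected) (o o' x y : X) :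
    gromovProduct Γ o x y ≤ gromovProduct Γ o' x y + Γ.dist o o' := by
  simp only [gromovProduct]
  linarith [cast_dist_triangle hΓ o o' x, cast_dist_triangle hΓ o o' y]

lemma gromovProduct_sub_dist_le (hΓ : Γ.Connected) (o x x' y : X) :
    gromovProduct Γ o x y - Γ.dist x x' ≤ gromovProduct Γ o x' y := by
  simp only [gromovProduct]
  linarith [cast_dist_triangle_right hΓ o x x', cast_dist_triangle_left hΓ x' y x]

lemma dist_eq_sub_gromovProduct (o x y : X) :
    (Γ.dist x y : ℝ) = Γ.dist o x + Γ.dist o y - 2 * gromovProduct Γ o x y := by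
  simp only [gromovProduct]
  ring

/-- The vertices `γ 0, …, γ n` form, in this order, a shortest path. -/
def IsGeodesicUpTo (Γ : SimpleGraph X) (γ : ℕ → X) (n : ℕ) : Prop :=
  ∀ i j, i ≤ j → j ≤ n → Γ.dist (γ i) (γ j) = j - i

lemma dist_le_sub_of_forall_succ (hΓ : Γ.Connected) {γ : ℕ → X} {n : ℕ}
    (hstep : ∀ i < n, Γ.dist (γ i) (γ (i + 1)) ≤ 1) {i j : ℕ} (hij : i ≤ j) (hj : j ≤ n) :
    Γ.dist (γ i) (γ j) ≤ j - i := by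
  induction j, hij using Nat.le_induction with
  | base => simp
  | succ j hij ih =>
    have hprev := ih (by omega)
    have hlast := hstep j (by omega)
    have htri := hΓ.dist_triangle (u := γ i) (v := γ j) (w := γ (j + 1))
    omega

lemma isGeodesicUpTo_of_le_dist (hΓ : Γ.Connected) {γ : ℕ → X} {n : ℕ}
    (hstep : ∀ i < n, Γ.dist (γ i) (γ (i + 1)) ≤ 1) (hn : n ≤ Γ.dist (γ 0) (γ n)) :
    IsGeodesicUpTo Γ γ n := by
  intro i j hij hj
  have hdij := dist_le_sub_of_forall_succ hΓ hstep hij hj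
  have hd0i := dist_le_sub_of_forall_succ hΓ hstep (Nat.zero_le i) (hij.trans hj)
  have hdjn := dist_le_sub_of_forall_succ hΓ hstep hj le_rfl
  have htri := hΓ.dist_triangle (u := γ 0) (v := γ i) (w := γ n)
  have htri' := hΓ.dist_triangle (u := γ i) (v := γ j) (w := γ n)
  omega

lemma IsShortest.isGeodesicUpTo_getVert (hΓ : Γ.Connected) {x y : X} {P : Γ.Walk x y}
    (hP : IsShortest P) : IsGeodesicUpTo Γ P.getVert P.length := by
  apply isGeodesicUpTo_of_le_dist hΓ
  · intro i hi
    exact (SimpleGraph.dist_eq_one_iff_adj.2 (P.adj_getVert_succ hi)).le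
  · rw [P.getVert_zero, P.getVert_length, ← hP]

lemma IsGeodesicUpTo.mem_interval {γ : ℕ → X} {n : ℕ} (hγ : IsGeodesicUpTo Γ γ n) {i j k : ℕ}
    (hij : i ≤ j) (hjk : j ≤ k) (hk : k ≤ n) : γ j ∈ interval Γ (γ i) (γ k) := by
  rw [TreeAmalgam.mem_interval, hγ i j hij (hjk.trans hk), hγ j k hjk hk,
    hγ i k (hij.trans hjk) hk]
  omega

lemma exists_isShortest (hΓ : Γ.Connected) (x y : X) : ∃ P : Γ.Walk x y, IsShortest P :=
  hΓ.exists_walk_length_eq_dist x y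

lemma exists_isGeodesicUpTo (hΓ : Γ.Connected) (x y : X) :
    ∃ γ : ℕ → X, γ 0 = x ∧ γ (Γ.dist x y) = y ∧ IsGeodesicUpTo Γ γ (Γ.dist x y) := by
  obtain ⟨P, hP⟩ := exists_isShortest hΓ x y
  have hlen : P.length = Γ.dist x y := hP
  exact ⟨P.getVert, P.getVert_zero, hlen ▸ P.getVert_length,
    hlen ▸ hP.isGeodesicUpTo_getVert hΓ⟩

lemma IsShortest.mem_interval {x y : X} {P : Γ.Walk x y} (hP : IsShortest P) {a : X}
    (ha : a ∈ P.support) : a ∈ interval Γ x y := by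
  classical
  have hlen := congrArg SimpleGraph.Walk.length (P.take_spec ha)
  rw [SimpleGraph.Walk.length_append, hP] at hlen
  have htake := SimpleGraph.dist_le (P.takeUntil a ha)
  have hdrop := SimpleGraph.dist_le (P.dropUntil a ha)
  have htri := (P.takeUntil a ha).reachable.dist_triangle_left y
  rw [TreeAmalgam.mem_interval]
  omega

lemma exists_isShortest_of_mem_interval (hΓ : Γ.Connected) {x y w : X}
    (hw : w ∈ interval Γ x y) : ∃ P : Γ.Walk x y, IsShortest P ∧ w ∈ P.support := by
  obtain ⟨P, hP⟩ := exists_isShortest hΓ x w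
  obtain ⟨Q, hQ⟩ := exists_isShortest hΓ w y
  refine ⟨P.append Q, ?_, by simp⟩
  simp only [IsShortest, SimpleGraph.Walk.length_append] at *
  rw [hP, hQ, hw]

lemma exists_isGeodesicUpTo_of_mem_interval (hΓ : Γ.Connected) {x y v : X}
    (hv : v ∈ interval Γ x y) : ∃ γ : ℕ → X, ∃ i ≤ Γ.dist x y, γ 0 = x ∧ γ i = v ∧
      γ (Γ.dist x y) = y ∧ IsGeodesicUpTo Γ γ (Γ.dist x y) := by
  obtain ⟨P, hP, hvP⟩ := exists_isShortest_of_mem_interval hΓ hv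
  obtain ⟨i, hi, hle⟩ := SimpleGraph.Walk.mem_support_iff_exists_getVert.1 hvP
  have hlen : P.length = Γ.dist x y := hP
  exact ⟨P.getVert, i, hlen ▸ hle, P.getVert_zero, hi, hlen ▸ P.getVert_length,
    hlen ▸ hP.isGeodesicUpTo_getVert hΓ⟩

lemma exists_adj_mem_interval (hΓ : Γ.Connected) {x y : X} (hxy : x ≠ y) :
    ∃ z, Γ.Adj x z ∧ z ∈ interval Γ x y := by
  obtain ⟨γ, rfl, hend, hγ⟩ := exists_isGeodesicUpTo hΓ x y
  have hpos := hΓ.pos_dist_of_ne hxy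
  refine ⟨γ 1, SimpleGraph.dist_eq_one_iff_adj.1 (hγ 0 1 (by omega) hpos), ?_⟩
  simpa only [hend] using hγ.mem_interval (Nat.zero_le 1) hpos le_rfl

lemma exists_boundary_mem_interval (hΓ : Γ.Connected) {x y : X} {S : Set X} (hx : x ∈ S)
    (hy : y ∉ S) : ∃ a b, Γ.Adj a b ∧ a ∈ S ∧ b ∉ S ∧ a ∈ interval Γ x y ∧ b ∈ interval Γ x y := by
  obtain ⟨P, hP⟩ := exists_isShortest hΓ x y
  obtain ⟨d, hd, hfst, hsnd⟩ := P.exists_boundary_dart S hx hy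
  exact ⟨d.fst, d.snd, d.adj, hfst, hsnd,
    hP.mem_interval (P.dart_fst_mem_support_of_mem_darts hd),
    hP.mem_interval (P.dart_snd_mem_support_of_mem_darts hd)⟩

/-! ### Thin triangles and the four-point inequality -/

/-- Every side of a triangle whose sides are intervals lies in the `δ`-neighbourhood of the two
other sides. Unlike `IsDeltaHyperbolic` this considers all shortest paths at once, and `δ` is a
natural number. -/
def ThinIntervals (Γ : SimpleGraph X) (δ : ℕ) : Prop :=
  ∀ x y z w, w ∈ interval Γ x y → ∃ w', (w' ∈ interval Γ x z ∨ w' ∈ interval Γ z y) ∧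
    Γ.dist w w' ≤ δ

/-- Gromov's four-point inequality, which turns hyperbolicity into an ultrametric-like inequality
for Gromov products. -/
def FourPoint (Γ : SimpleGraph X) (c : ℝ) : Prop :=
  ∀ o x y z, min (gromovProduct Γ o x y) (gromovProduct Γ o y z) - c ≤ gromovProduct Γ o x z

lemma ThinIntervals.mono {δ ε : ℕ} (h : ThinIntervals Γ δ) (hle : δ ≤ ε) : ThinIntervals Γ ε :=
  fun x y z w hw => (h x y z w hw).imp fun _ => And.imp_right hle.trans'

lemma FourPoint.nonneg {c : ℝ} (h4 : FourPoint Γ c) (o : X) : 0 ≤ c := by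
  simpa [gromovProduct] using h4 o o o o

lemma FourPoint.le_gromovProduct {c : ℝ} (h4 : FourPoint Γ c) {o x y z : X} {n : ℝ}
    (hxy : n ≤ gromovProduct Γ o x y) (hyz : n ≤ gromovProduct Γ o y z) :
    n - c ≤ gromovProduct Γ o x z := by
  linarith [h4 o x y z, le_min hxy hyz]

theorem IsHyperbolic.thinIntervals (hΓ : Γ.Connected) (h : IsHyperbolic Γ) :
    ∃ δ, ThinIntervals Γ δ := by
  obtain ⟨δ, -, hthin⟩ := h
  refine ⟨⌈δ⌉₊, fun x y z w hw => ?_⟩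
  obtain ⟨P, hP, hwP⟩ := exists_isShortest_of_mem_interval hΓ hw
  obtain ⟨Q, hQ⟩ := exists_isShortest hΓ y z
  obtain ⟨R, hR⟩ := exists_isShortest hΓ x z
  obtain ⟨b, hb, hd⟩ := hthin x y z P Q R hP hQ hR w hwP
  refine ⟨b, ?_, by exact_mod_cast hd.trans (Nat.le_ceil δ)⟩
  rcases hb with hb | hb
  · exact Or.inr (mem_interval_comm.1 (hQ.mem_interval hb))
  · exact Or.inl (hR.mem_interval hb)

-- Walk from `x` to `y` until leaving the `δ`-neighbourhood of the side `x o`.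
lemma ThinIntervals.exists_mem_near_both (hΓ : Γ.Connected) {δ : ℕ} (h : ThinIntervals Γ δ)
    (o x y : X) : ∃ w ∈ interval Γ x y, ∃ a ∈ interval Γ x o, ∃ b ∈ interval Γ o y,
      Γ.dist w a + Γ.dist w b ≤ 2 * δ + 1 := by
  by_cases hy : ∃ a ∈ interval Γ x o, Γ.dist y a ≤ δ
  · obtain ⟨a, ha, hd⟩ := hy
    refine ⟨y, right_mem_interval _ _, a, ha, y, right_mem_interval _ _, ?_⟩
    rw [SimpleGraph.dist_self]
    omega
  · obtain ⟨v, w, hvw, ⟨a, ha, hva⟩, hw, hvI, hwI⟩ :=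
      exists_boundary_mem_interval hΓ (x := x) (y := y)
        (S := {w | ∃ a ∈ interval Γ x o, Γ.dist w a ≤ δ}) ⟨x, left_mem_interval _ _, by simp⟩ hy
    obtain ⟨b, hb, hwb⟩ := h x y o w hwI
    have hb : b ∈ interval Γ o y := hb.resolve_left fun hb => hw ⟨b, hb, hwb⟩
    have hvw := SimpleGraph.dist_eq_one_iff_adj.2 hvw
    have htri := hΓ.dist_triangle (u := v) (v := w) (w := b)
    exact ⟨v, hvI, a, ha, b, hb, by omega⟩

lemma ThinIntervals.exists_dist_le (hΓ : Γ.Connected) {δ : ℕ} (h : ThinIntervals Γ δ)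
    (o x y : X) : ∃ w ∈ interval Γ x y, (Γ.dist o w : ℝ) ≤ gromovProduct Γ o x y + (2 * δ + 1) := by
  obtain ⟨w, hw, a, ha, b, hb, hwab⟩ := h.exists_mem_near_both hΓ o x y
  refine ⟨w, hw, ?_⟩
  have hwab : (Γ.dist w a : ℝ) + Γ.dist w b ≤ 2 * δ + 1 := by exact_mod_cast hwab
  have hao := cast_dist_add_dist (mem_interval_comm.1 ha)
  rw [Γ.dist_comm (u := a) (v := x)] at hao
  simp only [gromovProduct]
  linarith [cast_dist_add_dist hw, cast_dist_add_dist hb, cast_dist_triangle_right hΓ o w a,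
    cast_dist_triangle_right hΓ o w b, cast_dist_triangle_right hΓ x w a,
    cast_dist_triangle hΓ w b y]

theorem ThinIntervals.fourPoint (hΓ : Γ.Connected) {δ : ℕ} (h : ThinIntervals Γ δ) :
    FourPoint Γ (3 * δ + 1) := by
  intro o x y z
  obtain ⟨w, hw, how⟩ := h.exists_dist_le hΓ o x z
  obtain ⟨w', hw', hd⟩ := h x z y w hw
  have hd : (Γ.dist w w' : ℝ) ≤ δ := by exact_mod_cast hd
  have how' := cast_dist_triangle hΓ o w w'
  rcases hw' with hw' | hw'
  · linarith [gromovProduct_le_dist_of_mem hΓ (o := o) hw',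
      min_le_left (gromovProduct Γ o x y) (gromovProduct Γ o y z)]
  · linarith [gromovProduct_le_dist_of_mem hΓ (o := o) hw',
      min_le_right (gromovProduct Γ o x y) (gromovProduct Γ o y z)]

lemma FourPoint.dist_le_of_mem_interval {c : ℝ} (h4 : FourPoint Γ c) {x y w w' : X}
    (hw : w ∈ interval Γ x y) (hw' : w' ∈ interval Γ x y) (hd : Γ.dist x w = Γ.dist x w') :
    (Γ.dist w w' : ℝ) ≤ 2 * c := by
  have hwy := gromovProduct_eq_dist_of_mem hw
  have hyw' := gromovProduct_eq_dist_of_mem hw'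
  rw [← hd, gromovProduct_comm] at hyw'
  have hww' := h4.le_gromovProduct hwy.ge hyw'.ge
  rw [dist_eq_sub_gromovProduct x, ← hd]
  linarith

lemma FourPoint.exists_mem_support (hΓ : Γ.Connected) {c : ℝ} (h4 : FourPoint Γ c)
    {x y w : X} (hw : w ∈ interval Γ x y) {P : Γ.Walk x y} (hP : IsShortest P) :
    ∃ b ∈ P.support, (Γ.dist w b : ℝ) ≤ 2 * c := by
  have hlen : Γ.dist x w ≤ P.length := by rw [hP, ← hw]; omega
  have hd : Γ.dist x w = Γ.dist x (P.getVert (Γ.dist x w)) := by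
    simpa using (hP.isGeodesicUpTo_getVert hΓ 0 _ (Nat.zero_le _) hlen).symm
  exact ⟨_, P.getVert_mem_support _,
    h4.dist_le_of_mem_interval hw (hP.mem_interval (P.getVert_mem_support _)) hd⟩

theorem ThinIntervals.isHyperbolic (hΓ : Γ.Connected) {δ : ℕ} (h : ThinIntervals Γ δ) :
    IsHyperbolic Γ := by
  refine ⟨δ + 2 * (3 * δ + 1), by positivity, fun x y z P Q R hP hQ hR a ha => ?_⟩
  obtain ⟨w, hw, haw⟩ := h x y z a (hP.mem_interval ha)
  have haw : (Γ.dist a w : ℝ) ≤ δ := by exact_mod_cast haw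
  rcases hw with hw | hw
  · obtain ⟨b, hb, hwb⟩ := (h.fourPoint hΓ).exists_mem_support hΓ hw hR
    exact ⟨b, Or.inr hb, by linarith [cast_dist_triangle hΓ a w b]⟩
  · obtain ⟨b, hb, hwb⟩ := (h.fourPoint hΓ).exists_mem_support hΓ (mem_interval_comm.1 hw) hQ
    exact ⟨b, Or.inl hb, by linarith [cast_dist_triangle hΓ a w b]⟩

end Metric

/-! ### Sequences, rays and boundary points -/

section Sequences

variable {X : Type*} {Γ : SimpleGraph X}

/-- Corresponding members of two sequences of vertices have Gromov products that go to infinity: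
informally, the two sequences approach each other at infinity, but neither needs to converge. -/
def CoConvergent (Γ : SimpleGraph X) (x y : ℕ → X) : Prop :=
  ∀ o, Tendsto (fun i => gromovProduct Γ o (x i) (y i)) atTop atTop

/-- A Gromov sequence, also called a sequence converging at infinity: the Gromov products of its
members go to infinity. -/
def IsGromovSequence (Γ : SimpleGraph X) (x : ℕ → X) : Prop :=
  ∀ o, Tendsto (fun p : ℕ × ℕ => gromovProduct Γ o (x p.1) (x p.2)) atTop atTop

lemma tendsto_gromovProduct_of_base (hΓ : Γ.Connected) {ι : Type*} {l : Filter ι} {x y : ι → X}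
    (o o' : X) (h : Tendsto (fun i => gromovProduct Γ o (x i) (y i)) l atTop) :
    Tendsto (fun i => gromovProduct Γ o' (x i) (y i)) l atTop := by
  refine tendsto_atTop_mono (fun i => ?_) (tendsto_atTop_add_const_right _ (-(Γ.dist o o' : ℝ)) h)
  linarith [gromovProduct_le_add_dist_base hΓ o o' (x i) (y i)]

lemma CoConvergent.of_base (hΓ : Γ.Connected) {x y : ℕ → X} (o : X)
    (h : Tendsto (fun i => gromovProduct Γ o (x i) (y i)) atTop atTop) : CoConvergent Γ x y :=
  fun o' => tendsto_gromovProduct_of_base hΓ o o' h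

lemma IsGromovSequence.of_base (hΓ : Γ.Connected) {x : ℕ → X} (o : X)
    (h : ∀ M : ℝ, ∃ n, ∀ i ≥ n, ∀ j ≥ n, M ≤ gromovProduct Γ o (x i) (x j)) :
    IsGromovSequence Γ x := fun o' =>
  tendsto_gromovProduct_of_base hΓ o o' <|
    tendsto_atTop.2 fun M => eventually_atTop_prod_self'.2 (h M)

lemma IsGromovSequence.exists_forall_ge {x : ℕ → X} (h : IsGromovSequence Γ x) (o : X) (M : ℝ) :
    ∃ n, ∀ i ≥ n, ∀ j ≥ n, M ≤ gromovProduct Γ o (x i) (x j) :=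
  eventually_atTop_prod_self'.1 ((h o).eventually_ge_atTop M)

lemma IsGromovSequence.coConvergent_comp {x : ℕ → X} (h : IsGromovSequence Γ x) {φ : ℕ → ℕ}
    (hφ : Tendsto φ atTop atTop) : CoConvergent Γ (x ∘ φ) x := by
  refine fun o => tendsto_atTop.2 fun M => ?_
  obtain ⟨n, hn⟩ := h.exists_forall_ge o M
  filter_upwards [hφ.eventually_ge_atTop n, eventually_ge_atTop n] with i hφi hi
  exact hn _ hφi _ hi

lemma IsGromovSequence.coConvergent_self {x : ℕ → X} (h : IsGromovSequence Γ x) :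
    CoConvergent Γ x x :=
  h.coConvergent_comp tendsto_id

lemma CoConvergent.symm {x y : ℕ → X} (h : CoConvergent Γ x y) : CoConvergent Γ y x := by
  intro o
  simpa only [gromovProduct_comm _ (y _) (x _)] using h o

lemma CoConvergent.eventually_ne {x y : ℕ → X} (h : CoConvergent Γ x y) (v : X) :
    ∀ᶠ n in atTop, v ≠ y n := by
  filter_upwards [(h v).eventually_gt_atTop 0] with n hn hv
  rw [← hv] at hn
  simp [gromovProduct, Γ.dist_comm (v := v)] at hn

lemma CoConvergent.trans {c : ℝ} (h4 : FourPoint Γ c) {x y z : ℕ → X}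
    (hxy : CoConvergent Γ x y) (hyz : CoConvergent Γ y z) : CoConvergent Γ x z := by
  refine fun o => tendsto_atTop.2 fun M => ?_
  filter_upwards [(hxy o).eventually_ge_atTop (M + c), (hyz o).eventually_ge_atTop (M + c)]
    with i hxy hyz
  linarith [h4.le_gromovProduct hxy hyz]

lemma FourPoint.le_gromovProduct_of_three {c : ℝ} (h4 : FourPoint Γ c) {o x y z w : X} {M : ℝ}
    (hxy : M ≤ gromovProduct Γ o x y) (hyz : M ≤ gromovProduct Γ o y z)
    (hzw : M ≤ gromovProduct Γ o z w) : M - 2 * c ≤ gromovProduct Γ o x w := by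
  linarith [h4.nonneg o, h4.le_gromovProduct (h4.le_gromovProduct hxy hyz)
    (hzw.trans' (by linarith [h4.nonneg o]))]

theorem IsGromovSequence.coConvergent (hΓ : Γ.Connected) {c : ℝ} (h4 : FourPoint Γ c)
    {x y : ℕ → X} (hx : IsGromovSequence Γ x) (hy : IsGromovSequence Γ y) (o : X)
    (hxy : ∀ (M : ℝ) (n : ℕ), ∃ i ≥ n, ∃ j ≥ n, M ≤ gromovProduct Γ o (x i) (y j)) :
    CoConvergent Γ x y := by
  refine .of_base hΓ o (tendsto_atTop.2 fun M => ?_)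
  obtain ⟨m, hm⟩ := hx.exists_forall_ge o (M + 2 * c)
  obtain ⟨n, hn⟩ := hy.exists_forall_ge o (M + 2 * c)
  obtain ⟨i, hi, j, hj, hij⟩ := hxy (M + 2 * c) (max m n)
  filter_upwards [eventually_ge_atTop (max m n)] with k hk
  linarith [h4.le_gromovProduct_of_three (hm k (le_of_max_le_left hk) i (le_of_max_le_left hi)) hij
    (hn j (le_of_max_le_right hj) k (le_of_max_le_right hk))]

lemma FourPoint.eventually_le_gromovProduct {c : ℝ} (h4 : FourPoint Γ c)
    {x y x' y' : ℕ → X} (hx : CoConvergent Γ x x') (hy : CoConvergent Γ y y') {o : X} {M : ℝ}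
    (hxy : ∀ᶠ i in atTop, M ≤ gromovProduct Γ o (x i) (y i)) :
    ∀ᶠ i in atTop, M - 2 * c ≤ gromovProduct Γ o (x' i) (y' i) := by
  filter_upwards [hxy, (hx.symm o).eventually_ge_atTop M, (hy o).eventually_ge_atTop M]
    with i hxy hx hy
  exact h4.le_gromovProduct_of_three hx hxy hy

lemma GeodesicRay.dist_vertex (r : GeodesicRay Γ) {i j : ℕ} (hij : i ≤ j) :
    Γ.dist (r.vertex i) (r.vertex j) = j - i := by
  obtain ⟨k, rfl⟩ := Nat.exists_eq_add_of_le hij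
  rw [r.geodesic, Nat.add_sub_cancel_left]

lemma GeodesicRay.dist_zero (r : GeodesicRay Γ) (i : ℕ) :
    Γ.dist (r.vertex 0) (r.vertex i) = i := by
  simpa using r.dist_vertex (Nat.zero_le i)

lemma GeodesicRay.mem_interval (r : GeodesicRay Γ) {i j k : ℕ} (hij : i ≤ j) (hjk : j ≤ k) :
    r.vertex j ∈ interval Γ (r.vertex i) (r.vertex k) := by
  rw [TreeAmalgam.mem_interval, r.dist_vertex hij, r.dist_vertex hjk,
    r.dist_vertex (hij.trans hjk)]
  omega

lemma GeodesicRay.adj_succ (r : GeodesicRay Γ) (i : ℕ) :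
    Γ.Adj (r.vertex i) (r.vertex (i + 1)) := by
  rw [← SimpleGraph.dist_eq_one_iff_adj, r.geodesic]

lemma GeodesicRay.gromovProduct_zero (r : GeodesicRay Γ) (i j : ℕ) :
    gromovProduct Γ (r.vertex 0) (r.vertex i) (r.vertex j) = min (i : ℝ) j := by
  wlog hij : i ≤ j generalizing i j
  · rw [gromovProduct_comm, this j i (by omega), min_comm]
  · rw [gromovProduct_eq_dist_of_mem (r.mem_interval (Nat.zero_le i) hij), r.dist_zero,
      min_eq_left (by exact_mod_cast hij)]

lemma GeodesicRay.isGromovSequence (hΓ : Γ.Connected) (r : GeodesicRay Γ) :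
    IsGromovSequence Γ r.vertex := by
  refine .of_base hΓ (r.vertex 0) fun M => ⟨⌈M⌉₊, fun i hi j hj => ?_⟩
  rw [r.gromovProduct_zero]
  exact le_min (Nat.ceil_le.1 hi) (Nat.ceil_le.1 hj)

lemma GeodesicRay.Equivalent.coConvergent (hΓ : Γ.Connected) {c : ℝ} (h4 : FourPoint Γ c)
    {r s : GeodesicRay Γ} (h : r.Equivalent s) : CoConvergent Γ r.vertex s.vertex := by
  obtain ⟨M, hrs, -⟩ := h
  refine (r.isGromovSequence hΓ).coConvergent hΓ h4 (s.isGromovSequence hΓ) (r.vertex 0)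
    fun B n => ?_
  obtain ⟨i, ⟨j, hij⟩, hi⟩ :=
    hrs.exists_gt (⌈B⌉₊ + n + M + Γ.dist (r.vertex 0) (s.vertex 0))
  have hj : i ≤ Γ.dist (r.vertex 0) (s.vertex 0) + j + M := by
    have hsj := hΓ.dist_triangle (u := r.vertex 0) (v := s.vertex 0) (w := s.vertex j)
    have hri := hΓ.dist_triangle (u := r.vertex 0) (v := s.vertex j) (w := r.vertex i)
    rw [s.dist_zero] at hsj
    rw [Γ.dist_comm (u := s.vertex j), r.dist_zero] at hri
    omega
  refine ⟨i, by omega, j, by omega, ?_⟩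
  have hclose := gromovProduct_sub_dist_le hΓ (r.vertex 0) (r.vertex i) (s.vertex j) (r.vertex i)
  rw [gromovProduct_self, r.dist_zero, gromovProduct_comm] at hclose
  have hij : (Γ.dist (r.vertex i) (s.vertex j) : ℝ) ≤ M := by exact_mod_cast hij
  have hi : (⌈B⌉₊ : ℝ) + M ≤ i := by exact_mod_cast (by omega)
  linarith [Nat.le_ceil B]

lemma CoConvergent.dist_vertex_le (hΓ : Γ.Connected) {c : ℝ} (h4 : FourPoint Γ c)
    {r s : GeodesicRay Γ} (h : CoConvergent Γ r.vertex s.vertex) (a : ℕ) :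
    (Γ.dist (r.vertex a) (s.vertex a) : ℝ) ≤
      3 * Γ.dist (r.vertex 0) (s.vertex 0) + 4 * c := by
  obtain ⟨i, hi, hai⟩ := (((h (r.vertex 0)).eventually_ge_atTop (a : ℝ)).and
    (eventually_ge_atTop a)).exists
  set d : ℝ := ((Γ.dist (r.vertex 0) (s.vertex 0) : ℕ) : ℝ)
  have hd : 0 ≤ d := Nat.cast_nonneg _
  have hai : (a : ℝ) ≤ i := by exact_mod_cast hai
  have hr : a - d ≤ gromovProduct Γ (r.vertex 0) (r.vertex a) (r.vertex i) := by
    rw [r.gromovProduct_zero, min_eq_left hai]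
    linarith [hd]
  have hs : a - d ≤ gromovProduct Γ (r.vertex 0) (s.vertex i) (s.vertex a) := by
    have := gromovProduct_le_add_dist_base hΓ (s.vertex 0) (r.vertex 0) (s.vertex i) (s.vertex a)
    rw [s.gromovProduct_zero, min_eq_right hai, Γ.dist_comm] at this
    linarith
  have hrs := h4.le_gromovProduct_of_three hr (by linarith) hs
  have hsa := cast_dist_triangle hΓ (r.vertex 0) (s.vertex 0) (s.vertex a)
  rw [s.dist_zero] at hsa
  rw [dist_eq_sub_gromovProduct (r.vertex 0), r.dist_zero]
  linarith

lemma CoConvergent.equivalent (hΓ : Γ.Connected) {c : ℝ} (h4 : FourPoint Γ c)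
    {r s : GeodesicRay Γ} (h : CoConvergent Γ r.vertex s.vertex) : r.Equivalent s := by
  have hclose (a : ℕ) : Γ.dist (r.vertex a) (s.vertex a) ≤
      ⌈3 * (Γ.dist (r.vertex 0) (s.vertex 0) : ℝ) + 4 * c⌉₊ := by
    exact_mod_cast (h.dist_vertex_le hΓ h4 a).trans (Nat.le_ceil _)
  exact ⟨_, Set.infinite_univ.mono fun a _ => ⟨a, hclose a⟩,
    Set.infinite_univ.mono fun a _ => ⟨a, Γ.dist_comm ▸ hclose a⟩⟩

theorem GeodesicRay.point_eq_iff (hΓ : Γ.Connected) {c : ℝ} (h4 : FourPoint Γ c)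
    {r s : GeodesicRay Γ} : r.point = s.point ↔ CoConvergent Γ r.vertex s.vertex := by
  refine ⟨fun h => ?_, fun h => Quot.sound (h.equivalent hΓ h4)⟩
  replace h := Quot.eqvGen_exact h
  induction h with
  | rel r s h => exact h.coConvergent hΓ h4
  | refl r => exact (r.isGromovSequence hΓ).coConvergent_self
  | symm r s _ ih => exact ih.symm
  | trans r s t _ _ ihrs ihst => exact ihrs.trans h4 ihst

lemma exists_point_eq (ξ : Boundary Γ) : ∃ r : GeodesicRay Γ, r.point = ξ := Quot.exists_rep ξ

theorem convergesTo_iff (hΓ : Γ.Connected) {δ : ℕ} (hδ : ThinIntervals Γ δ) {x : ℕ → X}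
    {s : GeodesicRay Γ} : ConvergesTo Γ x s.point ↔ CoConvergent Γ x s.vertex := by
  constructor
  · rintro ⟨y, hys, hy⟩
    rw [GeodesicRay.point_eq_iff hΓ (hδ.fourPoint hΓ)] at hys
    refine CoConvergent.trans (hδ.fourPoint hΓ) (fun o => ?_) hys
    obtain ⟨n, hn, hd⟩ := hy o
    refine tendsto_atTop_mono (fun i => ?_)
      (tendsto_atTop_add_const_right _ (-(2 * δ + 1 : ℝ)) (tendsto_natCast_atTop_atTop.comp hn))
    obtain ⟨w, hw, how⟩ := hδ.exists_dist_le hΓ o (x i) (y.vertex i)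
    obtain ⟨P, hP, hwP⟩ := exists_isShortest_of_mem_interval hΓ hw
    have hnw : (n i : ℝ) ≤ Γ.dist o w := by exact_mod_cast hd i P hP w hwP
    simp only [Function.comp_apply]
    linarith
  · intro h
    exact ⟨s, rfl, fun o => ⟨fun i => ⌊gromovProduct Γ o (x i) (s.vertex i)⌋₊,
      tendsto_nat_floor_atTop.comp (h o), fun i P hP a ha =>
        Nat.floor_le_of_le (gromovProduct_le_dist_of_mem hΓ (hP.mem_interval ha))⟩⟩

lemma Near.base_change (hΓ : Γ.Connected) {o o' : X} {m n : ℕ} (hmn : m + Γ.dist o o' ≤ n)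
    {ξ η : Boundary Γ} (h : Near Γ o n ξ η) : Near Γ o' m ξ η := by
  obtain ⟨r, s, hr, hs, N, hN⟩ := h
  refine ⟨r, s, hr, hs, N, fun i hi j hj => ?_⟩
  have hmn : (m : ℝ) + Γ.dist o o' ≤ n := by exact_mod_cast hmn
  linarith [hN i hi j hj, gromovProduct_le_add_dist_base hΓ o o' (r.vertex i) (s.vertex j)]

lemma Near.eventually_le (hΓ : Γ.Connected) {c : ℝ} (h4 : FourPoint Γ c)
    {o : X} {n : ℕ} {r s : GeodesicRay Γ} (h : Near Γ o n r.point s.point) {x y : ℕ → X}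
    (hx : CoConvergent Γ x r.vertex) (hy : CoConvergent Γ y s.vertex) :
    ∀ᶠ i in atTop, n - 2 * c ≤ gromovProduct Γ o (x i) (y i) := by
  obtain ⟨r', s', hr, hs, N, hN⟩ := h
  rw [GeodesicRay.point_eq_iff hΓ h4] at hr hs
  refine h4.eventually_le_gromovProduct (hr.trans h4 hx.symm) (hs.trans h4 hy.symm) ?_
  filter_upwards [eventually_ge_atTop N] with i hi
  exact hN i hi i hi

lemma near_of_eventually_le (hΓ : Γ.Connected) {c : ℝ} (h4 : FourPoint Γ c)
    {o : X} {n : ℕ} {r s : GeodesicRay Γ} {x y : ℕ → X}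
    (hx : CoConvergent Γ x r.vertex) (hy : CoConvergent Γ y s.vertex)
    (h : ∀ᶠ i in atTop, n + 4 * c ≤ gromovProduct Γ o (x i) (y i)) :
    Near Γ o n r.point s.point := by
  obtain ⟨m, hm⟩ := (r.isGromovSequence hΓ).exists_forall_ge o (n + 2 * c)
  obtain ⟨m', hm'⟩ := (s.isGromovSequence hΓ).exists_forall_ge o (n + 2 * c)
  obtain ⟨k, hk, hmk, hmk'⟩ := ((h4.eventually_le_gromovProduct hx hy h).and
    ((eventually_ge_atTop m).and (eventually_ge_atTop m'))).exists
  refine ⟨r, s, rfl, rfl, max m m', fun i hi j hj => ?_⟩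
  linarith [h4.le_gromovProduct_of_three (hm i (le_of_max_le_left hi) k hmk)
    (by linarith) (hm' k hmk' j (le_of_max_le_right hj))]

end Sequences

/-! ### Guessing geodesics -/

section Guessing

variable {X : Type*} {Γ : SimpleGraph X}

/-- A family of connected sets `L x y`, one for every pair of vertices, that behaves like the family
of geodesics in a hyperbolic graph: triangles are `h`-thin, and `L x y` is small if `x` and `y` are
equal or adjacent. The existence of such a family implies hyperbolicity. -/
structure GuessedGeodesics (Γ : SimpleGraph X) (L : X → X → Set X) (h : ℕ) : Prop where
  exists_walk : ∀ x y, ∃ P : Γ.Walk x y, ∀ a ∈ P.support, a ∈ L x y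
  thin : ∀ x y z w, w ∈ L x y → ∃ w', (w' ∈ L x z ∨ w' ∈ L z y) ∧ Γ.dist w w' ≤ h
  small : ∀ x y w, Γ.dist x y ≤ 1 → w ∈ L x y → Γ.dist w x ≤ h

/-- Whenever `γ a, …, γ b` is a part of length at most `n` of a shortest path, `L (γ a) (γ b)` stays
within distance `t` of this part. -/
def StaysWithin (Γ : SimpleGraph X) (L : X → X → Set X) (n t : ℕ) : Prop :=
  ∀ (γ : ℕ → X) (m : ℕ), IsGeodesicUpTo Γ γ m → ∀ a b, a ≤ b → b ≤ m → b - a ≤ n →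
    ∀ w ∈ L (γ a) (γ b), ∃ i, a ≤ i ∧ i ≤ b ∧ Γ.dist w (γ i) ≤ t

variable {L : X → X → Set X} {h : ℕ}

lemma IsGeodesicUpTo.dist_succ_le_one {γ : ℕ → X} {n : ℕ} (hγ : IsGeodesicUpTo Γ γ n) :
    ∀ i < n, Γ.dist (γ i) (γ (i + 1)) ≤ 1 := by
  intro i hi
  rw [hγ i (i + 1) (by omega) hi, Nat.add_sub_cancel_left]

lemma GuessedGeodesics.exists_dist_le_mul (hΓ : Γ.Connected) (hL : GuessedGeodesics Γ L h)
    {γ : ℕ → X} {n : ℕ} (hγ : ∀ i < n, Γ.dist (γ i) (γ (i + 1)) ≤ 1) (k : ℕ) :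
    ∀ a b, a ≤ b → b ≤ n → b - a ≤ 2 ^ k → ∀ w ∈ L (γ a) (γ b),
      ∃ i, a ≤ i ∧ i ≤ b ∧ Γ.dist w (γ i) ≤ (k + 1) * h := by
  induction k with
  | zero =>
    intro a b hab hb hlen w hw
    have hd := dist_le_sub_of_forall_succ hΓ hγ hab hb
    exact ⟨a, le_rfl, hab, by simpa using hL.small _ _ w (hd.trans (by simpa using hlen)) hw⟩
  | succ k ih =>
    intro a b hab hb hlen w hw
    rw [pow_succ] at hlen
    obtain ⟨w', hw', hd⟩ := hL.thin _ _ (γ ((a + b) / 2)) w hw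
    obtain ⟨i, hai, hib, hi⟩ : ∃ i, a ≤ i ∧ i ≤ b ∧ Γ.dist w' (γ i) ≤ (k + 1) * h := by
      rcases hw' with hw' | hw'
      · obtain ⟨i, hai, him, hi⟩ := ih a ((a + b) / 2) (by omega) (by omega) (by omega) w' hw'
        exact ⟨i, hai, by omega, hi⟩
      · obtain ⟨i, hmi, hib, hi⟩ := ih ((a + b) / 2) b (by omega) (by omega) (by omega) w' hw'
        exact ⟨i, by omega, hib, hi⟩
    refine ⟨i, hai, hib, ?_⟩
    calc Γ.dist w (γ i) ≤ Γ.dist w w' + Γ.dist w' (γ i) := hΓ.dist_triangle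
      _ ≤ h + (k + 1) * h := add_le_add hd hi
      _ = (k + 1 + 1) * h := by ring

lemma GuessedGeodesics.exists_staysWithin (hΓ : Γ.Connected) (hL : GuessedGeodesics Γ L h)
    (n : ℕ) : ∃ t, StaysWithin Γ L n t :=
  ⟨(n + 1) * h, fun _ _ hγ a b hab hb hlen => hL.exists_dist_le_mul hΓ hγ.dist_succ_le_one n a b
    hab hb (hlen.trans Nat.lt_two_pow_self.le)⟩

lemma GuessedGeodesics.dist_le_of_far (hΓ : Γ.Connected) (hL : GuessedGeodesics Γ L h)
    {n t : ℕ} (ht : StaysWithin Γ L n t) {γ : ℕ → X} {m a b : ℕ} (hγ : IsGeodesicUpTo Γ γ m)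
    (hab : a ≤ b) (hb : b ≤ m) (hlen : b - a ≤ n) {v w w' : X} (hwv : Γ.dist w v ≤ t)
    (hww' : Γ.dist w w' ≤ 2 * h) (hw' : w' ∈ L (γ a) (γ b))
    (hfar : a = b ∨ ∀ j, a ≤ j → j ≤ b → 3 * t ≤ Γ.dist (γ j) v) :
    Γ.dist w v ≤ 3 * h ∨ Γ.dist w (γ a) ≤ 3 * h := by
  rcases hfar with rfl | hfar
  · have hw'a := hL.small _ _ w' (by simp) hw'
    have htri := hΓ.dist_triangle (u := w) (v := w') (w := γ a)
    omega
  · obtain ⟨j, haj, hjb, hj⟩ := ht γ m hγ a b hab hb hlen w' hw'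
    have hjv := hfar j haj hjb
    have htri := hΓ.dist_triangle (u := γ j) (v := w) (w := v)
    have htri' := hΓ.dist_triangle (u := w) (v := w') (w := γ j)
    rw [Γ.dist_comm (u := γ j) (v := w)] at htri
    omega

-- If `γ i` is `t`-close to `w`, then two thin triangles cut off what happens outside the window of
-- radius `3 * t` around `i`; the window itself has length at most `2 ^ k`, so that bisecting it `k`
-- times gives a bound that is linear in `k`.
lemma StaysWithin.improve (hΓ : Γ.Connected) (hL : GuessedGeodesics Γ L h) {n t k : ℕ}
    (ht : StaysWithin Γ L n t) (hk : 6 * t ≤ 2 ^ k) : StaysWithin Γ L n ((3 + k) * h) := by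
  intro γ m hγ a b hab hb hlen w hw
  obtain ⟨i, hai, hib, hi⟩ := ht γ m hγ a b hab hb hlen w hw
  have hbound : 3 * h ≤ (3 + k) * h := Nat.mul_le_mul_right h (Nat.le_add_right 3 k)
  obtain ⟨x, hx⟩ : ∃ x, x = max a (i - 3 * t) := ⟨_, rfl⟩
  obtain ⟨y, hy⟩ : ∃ y, y = min b (i + 3 * t) := ⟨_, rfl⟩
  obtain ⟨u, hu, hwu⟩ := hL.thin _ _ (γ x) w hw
  rcases hu with hu | hu
  · have hfar : a = x ∨ ∀ j, a ≤ j → j ≤ x → 3 * t ≤ Γ.dist (γ j) (γ i) := by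
      refine or_iff_not_imp_left.2 fun hax j haj hjx => ?_
      rw [hγ j i (by omega) (by omega)]
      omega
    rcases hL.dist_le_of_far hΓ ht hγ (by omega) (by omega) (by omega) hi (by omega) hu hfar
      with hd | hd
    · exact ⟨i, hai, hib, hd.trans hbound⟩
    · exact ⟨a, le_rfl, hab, hd.trans hbound⟩
  obtain ⟨v, hv, huv⟩ := hL.thin _ _ (γ y) u hu
  have hwv := hΓ.dist_triangle (u := w) (v := u) (w := v)
  rcases hv with hv | hv
  · obtain ⟨j, hxj, hjy, hj⟩ := hL.exists_dist_le_mul hΓ hγ.dist_succ_le_one k x y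
      (by omega) (by omega) ((by omega : y - x ≤ 6 * t).trans hk) v hv
    have htri := hΓ.dist_triangle (u := w) (v := v) (w := γ j)
    have hsplit : (3 + k) * h = (k + 1) * h + 2 * h := by ring
    exact ⟨j, by omega, by omega, by omega⟩
  · have hfar : y = b ∨ ∀ j, y ≤ j → j ≤ b → 3 * t ≤ Γ.dist (γ j) (γ i) := by
      refine or_iff_not_imp_left.2 fun hyb j hyj hjb => ?_
      rw [Γ.dist_comm, hγ i j (by omega) (by omega)]
      omega
    rcases hL.dist_le_of_far hΓ ht hγ (by omega) (by omega) (by omega) hi (by omega) hv hfar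
      with hd | hd
    · exact ⟨i, hai, hib, hd.trans hbound⟩
    · exact ⟨y, by omega, by omega, hd.trans hbound⟩

lemma le_mul_sq_of_forall_le_mul {h t : ℕ} (ht : ∀ k, 6 * t ≤ 2 ^ k → t ≤ (3 + k) * h) :
    t ≤ 150 * h ^ 2 := by
  rcases Nat.eq_zero_or_pos t with rfl | hpos
  · exact Nat.zero_le _
  set m := Nat.log 4 (6 * t)
  have hupper : t ≤ (3 + 2 * (m + 1)) * h := by
    apply ht
    rw [pow_mul]
    exact (Nat.lt_pow_succ_log_self (by norm_num) _).le
  have hlower : (m + 1) ^ 2 ≤ 6 * t :=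
    calc (m + 1) ^ 2 ≤ (2 ^ m) ^ 2 := Nat.pow_le_pow_left Nat.lt_two_pow_self 2
      _ = 4 ^ m := by rw [← pow_mul, mul_comm, pow_mul]; norm_num
      _ ≤ 6 * t := Nat.pow_log_le_self 4 (by omega)
  have hm : m + 1 ≤ 30 * h := by
    refine Nat.le_of_mul_le_mul_right ?_ m.succ_pos
    nlinarith
  nlinarith

lemma GuessedGeodesics.staysWithin (hΓ : Γ.Connected) (hL : GuessedGeodesics Γ L h) (n : ℕ) :
    StaysWithin Γ L n (150 * h ^ 2) := by
  classical
  have hex := hL.exists_staysWithin hΓ n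
  have hle : Nat.find hex ≤ 150 * h ^ 2 := le_mul_sq_of_forall_le_mul fun k hk =>
    Nat.find_min' hex ((Nat.find_spec hex).improve hΓ hL hk)
  intro γ m hγ a b hab hb hlen w hw
  obtain ⟨i, hai, hib, hi⟩ := Nat.find_spec hex γ m hγ a b hab hb hlen w hw
  exact ⟨i, hai, hib, hi.trans hle⟩

lemma GuessedGeodesics.exists_dist_le (hΓ : Γ.Connected) (hL : GuessedGeodesics Γ L h)
    {γ : ℕ → X} {n : ℕ} (hγ : IsGeodesicUpTo Γ γ n) {w : X} (hw : w ∈ L (γ 0) (γ n)) :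
    ∃ i ≤ n, Γ.dist w (γ i) ≤ 150 * h ^ 2 := by
  obtain ⟨i, -, hi, hd⟩ :=
    hL.staysWithin hΓ n γ n hγ 0 n (Nat.zero_le n) le_rfl (Nat.sub_le n 0) w hw
  exact ⟨i, hi, hd⟩

lemma GuessedGeodesics.exists_mem_interval_dist_le (hΓ : Γ.Connected)
    (hL : GuessedGeodesics Γ L h) {x y w : X} (hw : w ∈ L x y) :
    ∃ v ∈ interval Γ x y, Γ.dist w v ≤ 150 * h ^ 2 := by
  obtain ⟨γ, rfl, hend, hγ⟩ := exists_isGeodesicUpTo hΓ x y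
  obtain ⟨i, hi, hd⟩ := hL.exists_dist_le hΓ hγ (by rwa [hend])
  refine ⟨γ i, ?_, hd⟩
  simpa only [hend] using hγ.mem_interval (Nat.zero_le i) hi le_rfl

-- The connected set `L x y` has to jump from the part of the geodesic before `v` to the part after
-- `v` along an edge.
lemma GuessedGeodesics.exists_mem_dist_le (hΓ : Γ.Connected) (hL : GuessedGeodesics Γ L h)
    {x y v : X} (hv : v ∈ interval Γ x y) :
    ∃ w ∈ L x y, Γ.dist v w ≤ 3 * (150 * h ^ 2) + 1 := by
  obtain ⟨γ, i, hi, rfl, rfl, hend, hγ⟩ := exists_isGeodesicUpTo_of_mem_interval hΓ hv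
  obtain ⟨P, hP⟩ := hL.exists_walk (γ 0) y
  set n := Γ.dist (γ 0) y
  set K := 150 * h ^ 2
  by_cases hy : ∃ j ≤ i, Γ.dist y (γ j) ≤ K
  · obtain ⟨j, hj, hd⟩ := hy
    have hjn := hγ j n (hj.trans hi) le_rfl
    have hin := hγ i n hi le_rfl
    rw [hend] at hjn hin
    rw [Γ.dist_comm] at hd
    exact ⟨y, hP y P.end_mem_support, by omega⟩
  · obtain ⟨d, hd, ⟨j, hj, hjd⟩, hsnd⟩ := P.exists_boundary_dart
      {w | ∃ j ≤ i, Γ.dist w (γ j) ≤ K} ⟨0, Nat.zero_le _, by simp⟩ hy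
    have hsndL := hP _ (P.dart_snd_mem_support_of_mem_darts hd)
    obtain ⟨k, hk, hkd⟩ := hL.exists_dist_le hΓ hγ (by rwa [hend])
    have hik : i < k := not_le.1 fun hle => hsnd ⟨k, hle, hkd⟩
    have hadj := SimpleGraph.dist_eq_one_iff_adj.2 d.adj
    have hjk := hΓ.dist_triangle (u := γ j) (v := d.fst) (w := γ k)
    have hfk := hΓ.dist_triangle (u := d.fst) (v := d.snd) (w := γ k)
    have hif := hΓ.dist_triangle (u := γ i) (v := γ j) (w := d.fst)
    rw [hγ j k (by omega) hk] at hjk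
    rw [Γ.dist_comm (u := γ i) (v := γ j), hγ j i hj hi] at hif
    rw [Γ.dist_comm (v := γ j)] at hjd
    exact ⟨d.fst, hP _ (P.dart_fst_mem_support_of_mem_darts hd), by omega⟩

theorem GuessedGeodesics.thinIntervals (hΓ : Γ.Connected) (hL : GuessedGeodesics Γ L h) :
    ThinIntervals Γ (600 * h ^ 2 + h + 1) := by
  intro x y z v hv
  obtain ⟨w, hw, hvw⟩ := hL.exists_mem_dist_le hΓ hv
  obtain ⟨w', hw', hww'⟩ := hL.thin x y z w hw
  have hvw' := hΓ.dist_triangle (u := v) (v := w) (w := w')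
  rcases hw' with hw' | hw' <;> obtain ⟨v', hv', hd⟩ := hL.exists_mem_interval_dist_le hΓ hw' <;>
    have hvv' := hΓ.dist_triangle (u := v) (v := w') (w := v')
  · exact ⟨v', Or.inl hv', by omega⟩
  · exact ⟨v', Or.inr hv', by omega⟩

end Guessing

/-! ### Rays as limits of shortest paths -/

section Konig

variable {X : Type*} {Γ : SimpleGraph X}

lemma exists_ray_of_forall_adj (hΓ : Γ.Connected) {w : ℕ → X}
    (hadj : ∀ k, Γ.Adj (w k) (w (k + 1)))
    (hmem : ∀ k, w k ∈ interval Γ (w 0) (w (k + 1))) :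
    ∃ s : GeodesicRay Γ, s.vertex = w := by
  have hstep (k : ℕ) : Γ.dist (w k) (w (k + 1)) = 1 := SimpleGraph.dist_eq_one_iff_adj.2 (hadj k)
  have hdist (k : ℕ) : Γ.dist (w 0) (w k) = k := by
    induction k with
    | zero => simp
    | succ k ih => rw [← mem_interval.1 (hmem k), ih, hstep]
  refine ⟨⟨w, fun i k => ?_⟩, rfl⟩
  have hgeod : IsGeodesicUpTo Γ w (i + k) :=
    isGeodesicUpTo_of_le_dist hΓ (fun j _ => (hstep j).le) (hdist _).ge
  rw [hgeod i (i + k) (by omega) le_rfl, Nat.add_sub_cancel_left]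

theorem exists_ray_of_frequently (hΓ : Γ.Connected) (o : X) (y : ℕ → X)
    (hext : ∀ v, (∃ᶠ n in atTop, v ∈ interval Γ o (y n)) →
      ∃ v', v' ≠ v ∧ v ∈ interval Γ o v' ∧ ∃ᶠ n in atTop, v' ∈ interval Γ o (y n)) :
    ∃ s : GeodesicRay Γ, s.vertex 0 = o ∧
      ∀ k, ∃ᶠ n in atTop, s.vertex k ∈ interval Γ o (y n) := by
  have hnext (v : {v // ∃ᶠ n in atTop, v ∈ interval Γ o (y n)}) :
      ∃ v' : {v // ∃ᶠ n in atTop, v ∈ interval Γ o (y n)},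
        Γ.Adj v.1 v'.1 ∧ v.1 ∈ interval Γ o v'.1 := by
    obtain ⟨v', hne, hvv', hfreq⟩ := hext v.1 v.2
    obtain ⟨z, hvz, hz⟩ := exists_adj_mem_interval hΓ hne.symm
    obtain ⟨hzv', hvz'⟩ := mem_interval_trans hΓ hvv' hz
    exact ⟨⟨z, hfreq.mono fun n hn => mem_interval_of_mem_of_mem hΓ hn hzv'⟩, hvz, hvz'⟩
  choose next hadj hmem using hnext
  let w (k : ℕ) := next^[k] ⟨o, .of_forall fun n => left_mem_interval o (y n)⟩
  have hw (k : ℕ) : w (k + 1) = next (w k) := Function.iterate_succ_apply' next k _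
  obtain ⟨s, hs⟩ := exists_ray_of_forall_adj hΓ (w := fun k => (w k).1)
    (fun k => hw k ▸ hadj (w k)) (fun k => hw k ▸ hmem (w k))
  exact ⟨s, by rw [hs]; rfl, fun k => by rw [hs]; exact (w k).2⟩

theorem exists_ray_of_finite (hΓ : Γ.Connected) (o : X) (y : ℕ → X)
    (hext : ∀ v, ∃ S : Set X, S.Finite ∧
      ∀ᶠ n in atTop, ∃ v' ∈ S, v' ≠ v ∧ v' ∈ interval Γ v (y n)) :
    ∃ s : GeodesicRay Γ, s.vertex 0 = o ∧
      ∀ k, ∃ᶠ n in atTop, s.vertex k ∈ interval Γ o (y n) := by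
  refine exists_ray_of_frequently hΓ o y fun v hv => ?_
  obtain ⟨S, hS, hev⟩ := hext v
  have hfreq : ∃ᶠ n in atTop, ∃ v' ∈ S,
      v' ≠ v ∧ v ∈ interval Γ o (y n) ∧ v' ∈ interval Γ v (y n) :=
    (hv.and_eventually hev).mono fun n ⟨hvn, v', hv', hne, hI⟩ => ⟨v', hv', hne, hvn, hI⟩
  obtain ⟨v', -, hv'⟩ := (frequently_exists_finite hS).1 hfreq
  obtain ⟨n, hne, hvn, hn⟩ := hv'.exists
  exact ⟨v', hne, (mem_interval_trans hΓ hvn hn).2,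
    hv'.mono fun n hn => (mem_interval_trans hΓ hn.2.1 hn.2.2).1⟩

theorem exists_ray_of_isLocallyFinite (hΓ : Γ.Connected) (hfin : IsLocallyFinite Γ) (o : X)
    {y : ℕ → X} (hy : ∀ v, ∀ᶠ n in atTop, v ≠ y n) :
    ∃ s : GeodesicRay Γ, s.vertex 0 = o ∧
      ∀ k, ∃ᶠ n in atTop, s.vertex k ∈ interval Γ o (y n) := by
  refine exists_ray_of_finite hΓ o y fun v => ⟨Γ.neighborSet v, hfin v, ?_⟩
  filter_upwards [hy v] with n hn
  obtain ⟨z, hvz, hz⟩ := exists_adj_mem_interval hΓ hn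
  exact ⟨z, hvz, hvz.ne', hz⟩

theorem coConvergent_of_frequently (hΓ : Γ.Connected) {c : ℝ} (h4 : FourPoint Γ c)
    {y : ℕ → X} (hy : IsGromovSequence Γ y) {s : GeodesicRay Γ}
    (hs : ∀ k, ∃ᶠ n in atTop, s.vertex k ∈ interval Γ (s.vertex 0) (y n)) :
    CoConvergent Γ y s.vertex := by
  refine ((s.isGromovSequence hΓ).coConvergent hΓ h4 hy (s.vertex 0) fun M n => ?_).symm
  obtain ⟨j, hnj, hj⟩ := frequently_atTop.1 (hs (max ⌈M⌉₊ n)) n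
  refine ⟨max ⌈M⌉₊ n, le_max_right _ _, j, hnj, ?_⟩
  rw [gromovProduct_eq_dist_of_mem hj, s.dist_zero]
  exact (Nat.le_ceil M).trans (by exact_mod_cast le_max_left _ _)

lemma finite_setOf_dist_le (hΓ : Γ.Connected) (hfin : IsLocallyFinite Γ) (o : X) (n : ℕ) :
    {x | Γ.dist x o ≤ n}.Finite := by
  induction n with
  | zero => exact (Set.finite_singleton o).subset fun x hx =>
      hΓ.dist_eq_zero_iff.1 (Nat.le_zero.1 hx)
  | succ n ih =>
    refine ((Set.finite_singleton o).union (ih.biUnion fun z _ => hfin z)).subset fun x hx => ?_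
    by_cases hxo : x = o
    · exact Or.inl hxo
    obtain ⟨z, hxz, hz⟩ := exists_adj_mem_interval hΓ hxo
    refine Or.inr (Set.mem_biUnion (x := z) ?_ hxz.symm)
    rw [mem_interval, SimpleGraph.dist_eq_one_iff_adj.2 hxz] at hz
    simp only [Set.mem_ofPred_eq] at hx ⊢
    omega

end Konig

/-! ### Directions in trees -/

section Tree

variable {W : Type*} {T : SimpleGraph W}

open Classical in
/-- The direction of `s` as seen from `t`: the neighbour of `t` on the way from `t` to `s`.  The
value is `t` itself if `s = t`. -/
noncomputable def toward (T : SimpleGraph W) (t s : W) : W :=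
  if h : ∃ z, T.Adj t z ∧ z ∈ interval T t s then h.choose else t

lemma toward_spec (hT : T.IsTree) {t s : W} (hst : s ≠ t) :
    T.Adj t (toward T t s) ∧ toward T t s ∈ interval T t s := by
  have hex := exists_adj_mem_interval hT.1 hst.symm
  rw [toward, dif_pos hex]
  exact hex.choose_spec

lemma toward_self (hT : T.IsTree) (t : W) : toward T t t = t :=
  dif_neg fun ⟨_, htz, hz⟩ => htz.ne' (eq_of_mem_interval_self hT.1 hz)

lemma toward_eq_self_iff (hT : T.IsTree) {t s : W} : toward T t s = t ↔ s = t := by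
  refine ⟨fun h => ?_, fun h => h ▸ toward_self hT s⟩
  by_contra hne
  exact (toward_spec hT hne).1.ne' h

lemma dist_toward (hT : T.IsTree) {t s : W} (hst : s ≠ t) :
    T.dist (toward T t s) s + 1 = T.dist t s := by
  obtain ⟨hadj, hmem⟩ := toward_spec hT hst
  rw [← mem_interval.1 hmem, SimpleGraph.dist_eq_one_iff_adj.2 hadj, add_comm]

lemma isShortest_of_isPath (hT : T.IsTree) {x y : W} {P : T.Walk x y} (hP : P.IsPath) :
    IsShortest P := by
  obtain ⟨Q, hQ, hlen⟩ := hT.1.exists_path_of_dist x y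
  rwa [(hT.existsUnique_path x y).unique hP hQ]

lemma exists_isPath_toward_notMem_support (hT : T.IsTree) {t s : W} (hst : s ≠ t) :
    ∃ P : T.Walk (toward T t s) s, P.IsPath ∧ t ∉ P.support := by
  obtain ⟨P, hP, hlen⟩ := hT.1.exists_path_of_dist (toward T t s) s
  refine ⟨P, hP, fun ht => ?_⟩
  have hmem := mem_interval.1 ((show IsShortest P from hlen).mem_interval ht)
  have hdist := dist_toward hT hst
  omega

theorem mem_interval_of_toward_ne (hT : T.IsTree) {t s s' : W}
    (hne : toward T t s ≠ toward T t s') : t ∈ interval T s s' := by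
  classical
  by_contra hnot
  have hs : s ≠ t := by rintro rfl; exact hnot (left_mem_interval _ _)
  have hs' : s' ≠ t := by rintro rfl; exact hnot (right_mem_interval _ _)
  -- Going to `s` first and then on to `s'` avoids `t`, so it starts with the same edge as the
  -- path from `t` to `s'`.
  obtain ⟨P, -, htP⟩ := exists_isPath_toward_notMem_support hT hs
  obtain ⟨Q, hQ, htQ⟩ := exists_isPath_toward_notMem_support hT hs'
  obtain ⟨R, hR, -⟩ := hT.existsUnique_path s s'
  have htR : t ∉ R.support := fun ht => hnot ((isShortest_of_isPath hT hR).mem_interval ht)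
  have htPR : t ∉ (P.append R).bypass.support := fun ht =>
    (SimpleGraph.Walk.mem_support_append_iff _ _ |>.1
      ((P.append R).support_bypass_subset_support ht)).elim htP htR
  have huniq := (hT.existsUnique_path t s').unique
    ((SimpleGraph.Walk.cons_isPath_iff (toward_spec hT hs).1 _).2
      ⟨(P.append R).bypass_isPath, htPR⟩)
    ((SimpleGraph.Walk.cons_isPath_iff (toward_spec hT hs').1 _).2 ⟨hQ, htQ⟩)
  simpa [hne] using congrArg (·.getVert 1) huniq

theorem mem_interval_iff_toward (hT : T.IsTree) {t s s' : W} :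
    t ∈ interval T s s' ↔ (toward T t s = toward T t s' → s = t) := by
  constructor
  · intro ht heq
    by_contra hs
    have hs' : s' ≠ t := fun h =>
      hs ((toward_eq_self_iff hT).1 (heq.trans ((toward_eq_self_iff hT).2 h)))
    have hdist := dist_toward hT hs
    have hdist' := dist_toward hT hs'
    have htri := hT.1.dist_triangle (u := s) (v := toward T t s) (w := s')
    rw [mem_interval, T.dist_comm (u := s) (v := t)] at ht
    rw [T.dist_comm (u := s) (v := toward T t s), heq] at htri
    rw [heq] at hdist
    omega
  · intro h
    by_cases heq : toward T t s = toward T t s'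
    · rw [h heq]; exact left_mem_interval _ _
    · exact mem_interval_of_toward_ne hT heq

lemma toward_of_adj (hT : T.IsTree) {t n : W} (hadj : T.Adj t n) : toward T t n = n := by
  have hdist := dist_toward hT hadj.ne'
  rw [SimpleGraph.dist_eq_one_iff_adj.2 hadj] at hdist
  exact hT.1.dist_eq_zero_iff.1 (by omega)

lemma toward_eq_of_adj_of_mem_interval (hT : T.IsTree) {t n s : W} (hadj : T.Adj t n)
    (hn : n ∈ interval T t s) : toward T t s = n := by
  by_contra hne
  have ht : t ∈ interval T n s :=
    mem_interval_of_toward_ne hT fun h => hne (h.symm.trans (toward_of_adj hT hadj))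
  rw [mem_interval, SimpleGraph.dist_eq_one_iff_adj.2 hadj] at hn
  rw [mem_interval, SimpleGraph.dist_eq_one_iff_adj.2 hadj.symm] at ht
  omega

lemma toward_eq_toward_of_adj (hT : T.IsTree) {t u v : W} (hadj : T.Adj u v) (hu : u ≠ t)
    (hv : v ≠ t) : toward T t u = toward T t v := by
  by_contra hne
  exact (eq_or_eq_of_mem_interval_of_adj hT.1 hadj (mem_interval_of_toward_ne hT hne)).elim
    hu.symm hv.symm

theorem thinIntervals_of_isTree (hT : T.IsTree) : ThinIntervals T 0 := by
  intro x y z w hw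
  refine ⟨w, ?_, by simp⟩
  rw [mem_interval_iff_toward hT] at hw
  by_cases h : toward T w x = toward T w z ∧ x ≠ w
  · right
    rw [mem_interval_iff_toward hT]
    exact fun hzy => absurd (hw (h.1.trans hzy)) h.2
  · left
    rw [mem_interval_iff_toward hT]
    exact fun hxz => not_not.1 fun hne => h ⟨hxz, hne⟩

lemma fourPoint_of_isTree (hT : T.IsTree) : FourPoint T 1 := by
  simpa using (thinIntervals_of_isTree hT).fourPoint hT.1

theorem eventually_toward_eq (hT : T.IsTree) {t : ℕ → W}
    (hstep : ∀ n, t n = t (n + 1) ∨ T.Adj (t n) (t (n + 1))) {a : W}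
    (hne : ∀ᶠ n in atTop, t n ≠ a) :
    ∃ b, T.Adj a b ∧ ∀ᶠ n in atTop, toward T a (t n) = b := by
  obtain ⟨n₀, hn₀⟩ := hne.exists_forall_of_atTop
  refine ⟨toward T a (t n₀), (toward_spec hT (hn₀ _ le_rfl)).1, ?_⟩
  filter_upwards [eventually_ge_atTop n₀] with n hn
  induction n, hn using Nat.le_induction with
  | base => rfl
  | succ n hn ih =>
    rw [← ih]
    rcases hstep n with h | h
    · rw [h]
    · exact (toward_eq_toward_of_adj hT h (hn₀ n hn) (hn₀ (n + 1) (by omega))).symm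

lemma GeodesicRay.eventually_ne {X : Type*} {Γ : SimpleGraph X} (r : GeodesicRay Γ) (a : X) :
    ∀ᶠ n in atTop, r.vertex n ≠ a := by
  filter_upwards [eventually_gt_atTop (Γ.dist (r.vertex 0) a)] with n hn h
  rw [← h, r.dist_zero] at hn
  omega

lemma GeodesicRay.eventually_toward_eq (hT : T.IsTree) (r : GeodesicRay T) (a : W) :
    ∃ b, T.Adj a b ∧ ∀ᶠ n in atTop, toward T a (r.vertex n) = b :=
  TreeAmalgam.eventually_toward_eq hT (fun n => Or.inr (r.adj_succ n)) (r.eventually_ne a)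

lemma GeodesicRay.toward_vertex (hT : T.IsTree) (r : GeodesicRay T) {m n : ℕ} (hmn : m < n) :
    toward T (r.vertex m) (r.vertex n) = r.vertex (m + 1) :=
  toward_eq_of_adj_of_mem_interval hT (r.adj_succ m) (r.mem_interval (Nat.le_succ m) hmn)

lemma GeodesicRay.mem_interval_of_toward_eq (hT : T.IsTree) (r : GeodesicRay T) {m : ℕ} {s : W}
    (hs : toward T (r.vertex m) s = r.vertex (m + 1)) :
    r.vertex m ∈ interval T (r.vertex 0) s := by
  rw [mem_interval_iff_toward hT, hs, ← toward_of_adj hT (r.adj_succ m),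
    ← mem_interval_iff_toward hT]
  exact r.mem_interval (Nat.zero_le m) (Nat.le_succ m)

lemma GeodesicRay.exists_toward_ne (hT : T.IsTree) (r : GeodesicRay T) (s : W) :
    ∃ m, toward T (r.vertex m) s ≠ r.vertex (m + 1) := by
  refine ⟨T.dist (r.vertex 0) s + 1, fun h => ?_⟩
  have hmem := r.mem_interval_of_toward_eq hT h
  rw [TreeAmalgam.mem_interval, r.dist_zero] at hmem
  omega

theorem exists_eventually_toward_ne (hT : T.IsTree) {r s : GeodesicRay T}
    (hrs : ¬ CoConvergent T r.vertex s.vertex) :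
    ∃ m, ∀ᶠ n in atTop, toward T (r.vertex m) (s.vertex n) ≠ r.vertex (m + 1) := by
  by_contra! hfreq
  refine hrs ((r.isGromovSequence hT.1).coConvergent hT.1 (fourPoint_of_isTree hT)
    (s.isGromovSequence hT.1) (r.vertex 0) fun M n => ?_)
  have hfreq : ∃ᶠ j in atTop, toward T (r.vertex (max ⌈M⌉₊ n)) (s.vertex j) =
      r.vertex (max ⌈M⌉₊ n + 1) := by
    simpa [Filter.Frequently] using hfreq (max ⌈M⌉₊ n)
  obtain ⟨j, hnj, hj⟩ := frequently_atTop.1 hfreq n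
  refine ⟨max ⌈M⌉₊ n, le_max_right _ _, j, hnj, ?_⟩
  rw [gromovProduct_eq_dist_of_mem (r.mem_interval_of_toward_eq hT hj), r.dist_zero]
  exact (Nat.le_ceil M).trans (by exact_mod_cast le_max_left _ _)

end Tree

/-! ### Trees of graphs -/

section TreeOfGraphs

variable {X W : Type*} {Γ : SimpleGraph X} {T : SimpleGraph W} {τ : X → W}
  {gate : W → W → X} {N δ : ℕ}

/-- The edges of `Γ` inside the fibres of `τ`. -/
def fibreGraph (Γ : SimpleGraph X) (τ : X → W) : SimpleGraph X where
  Adj x y := Γ.Adj x y ∧ τ x = τ y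
  symm := ⟨fun _ _ h => ⟨h.1.symm, h.2.symm⟩⟩
  loopless := ⟨fun _ h => Γ.irrefl h.1⟩

/-- The graph `Γ` is arranged along the tree `T` by `τ`: its fibres, with their own path metrics,
are connected, proper, and `δ`-thin, and the edges between two neighbouring fibres have their ends
in sets of diameter at most `N`. -/
structure TreeOfGraphs (Γ : SimpleGraph X) (T : SimpleGraph W) (τ : X → W) (N δ : ℕ) : Prop where
  isTree : T.IsTree
  surjective : Function.Surjective τ
  adj : ∀ {x y}, Γ.Adj x y → τ x = τ y ∨ T.Adj (τ x) (τ y)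
  reachable : ∀ {x y}, τ x = τ y → (fibreGraph Γ τ).Reachable x y
  exists_adj : ∀ {a b}, T.Adj a b → ∃ x y, τ x = a ∧ τ y = b ∧ Γ.Adj x y
  adhesion : ∀ {x y x' y'}, Γ.Adj x y → Γ.Adj x' y' → τ x = τ x' → τ y = τ y' → τ x ≠ τ y →
    (fibreGraph Γ τ).dist x x' ≤ N
  thin : ∀ {x y z w}, τ y = τ x → τ z = τ x → τ w = τ x → w ∈ interval (fibreGraph Γ τ) x y →
    ∃ w', τ w' = τ x ∧ (w' ∈ interval (fibreGraph Γ τ) x z ∨ w' ∈ interval (fibreGraph Γ τ) z y) ∧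
      (fibreGraph Γ τ).dist w w' ≤ δ
  finite : ∀ x n, {y | τ y = τ x ∧ (fibreGraph Γ τ).dist x y ≤ n}.Finite

/-- Vertices `gate a b` of the fibre over `a`, one for every edge `ab` of the tree, such that
`gate a b` and `gate b a` are adjacent. -/
def IsGate (Γ : SimpleGraph X) (T : SimpleGraph W) (τ : X → W) (gate : W → W → X) : Prop :=
  ∀ a b, T.Adj a b → τ (gate a b) = a ∧ Γ.Adj (gate a b) (gate b a)

open Classical in
/-- The vertex of the fibre over `t` through which `x` is reached from that fibre: `x` itself if it
lies in the fibre, and otherwise the gate in the direction of `x`. -/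
noncomputable def gateProj (T : SimpleGraph W) (τ : X → W) (gate : W → W → X) (t : W) (x : X) : X :=
  if τ x = t then x else gate t (toward T t (τ x))

/-- The union of the shortest paths inside the fibres between the gates on the way from `x`
to `y`. -/
def gatePath (Γ : SimpleGraph X) (T : SimpleGraph W) (τ : X → W) (gate : W → W → X) (x y : X) :
    Set X :=
  {w | τ w ∈ interval T (τ x) (τ y) ∧
    w ∈ interval (fibreGraph Γ τ) (gateProj T τ gate (τ w) x) (gateProj T τ gate (τ w) y)}

lemma fibreGraph_le : fibreGraph Γ τ ≤ Γ := fun _ _ h => h.1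

lemma eq_of_reachable_fibreGraph {x y : X} (h : (fibreGraph Γ τ).Reachable x y) : τ x = τ y := by
  obtain ⟨P⟩ := h
  induction P with
  | nil => rfl
  | cons h _ ih => exact h.2.trans ih

lemma le_mul_dist_of_adj (hΓ : Γ.Connected) {d : X → X → ℕ} {C : ℕ} (hself : ∀ x, d x x = 0)
    (htri : ∀ x y z, d x z ≤ d x y + d y z) (hadj : ∀ x y, Γ.Adj x y → d x y ≤ C) (x y : X) :
    d x y ≤ C * Γ.dist x y := by
  obtain ⟨P, hP⟩ := hΓ.exists_walk_length_eq_dist x y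
  rw [← hP]
  clear hP
  induction P with
  | nil => simp [hself]
  | @cons u v w huv _ ih =>
    rw [SimpleGraph.Walk.length_cons, mul_add, mul_one]
    linarith [htri u v w, hadj u v huv]

namespace TreeOfGraphs

lemma nonempty (hτ : TreeOfGraphs Γ T τ N δ) : Nonempty X :=
  hτ.isTree.1.nonempty.map (Function.surjInv hτ.surjective)

theorem connected (hτ : TreeOfGraphs Γ T τ N δ) : Γ.Connected := by
  have hreach {a b : W} (P : T.Walk a b) : ∀ x y, τ x = a → τ y = b → Γ.Reachable x y := by
    induction P with
    | nil =>
      intro x y hx hy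
      exact (hτ.reachable (hx.trans hy.symm)).mono fibreGraph_le
    | cons hab _ ih =>
      intro x y hx hy
      obtain ⟨x', y', hx', hy', hadj⟩ := hτ.exists_adj hab
      have hxx' := (hτ.reachable (hx.trans hx'.symm)).mono fibreGraph_le
      exact (hxx'.trans hadj.reachable).trans (ih y' y hy' hy)
  have := hτ.nonempty
  refine ⟨fun x y => ?_⟩
  obtain ⟨P⟩ := hτ.isTree.1.preconnected (τ x) (τ y)
  exact hreach P x y rfl rfl

lemma fibre_dist_triangle (hτ : TreeOfGraphs Γ T τ N δ) {x y z : X} (hxy : τ x = τ y) :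
    (fibreGraph Γ τ).dist x z ≤ (fibreGraph Γ τ).dist x y + (fibreGraph Γ τ).dist y z :=
  (hτ.reachable hxy).dist_triangle_left z

lemma dist_le_fibre_dist (hτ : TreeOfGraphs Γ T τ N δ) {x y : X} (hxy : τ x = τ y) :
    Γ.dist x y ≤ (fibreGraph Γ τ).dist x y :=
  (hτ.reachable hxy).dist_anti fibreGraph_le

lemma tree_dist_le (hτ : TreeOfGraphs Γ T τ N δ) (x y : X) :
    T.dist (τ x) (τ y) ≤ Γ.dist x y := by
  rw [← one_mul (Γ.dist x y)]
  refine le_mul_dist_of_adj hτ.connected (d := fun x y => T.dist (τ x) (τ y)) (by simp)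
    (fun _ _ _ => hτ.isTree.1.dist_triangle) (fun x y hxy => ?_) x y
  rcases hτ.adj hxy with h | h
  · simp [h]
  · exact (SimpleGraph.dist_eq_one_iff_adj.2 h).le

theorem exists_crossing (hτ : TreeOfGraphs Γ T τ N δ) {a b : W} {x y : X} (hab : T.Adj a b)
    (hx : toward T a (τ x) ≠ b) (hy : toward T a (τ y) = b) :
    ∃ p q, Γ.Adj p q ∧ τ p = a ∧ τ q = b ∧ p ∈ interval Γ x y ∧ q ∈ interval Γ x y := by
  obtain ⟨p, q, hpq, hp, hq, hpI, hqI⟩ := exists_boundary_mem_interval hτ.connected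
    (S := {x | toward T a (τ x) ≠ b}) hx (by simpa using hy)
  simp only [Set.mem_ofPred_eq, not_not] at hp hq
  have hne : τ p ≠ τ q := fun h => hp (h ▸ hq)
  have hadj := (hτ.adj hpq).resolve_left hne
  have hqa : τ q ≠ a := fun h => hab.ne (by rw [← hq, h, toward_self hτ.isTree])
  have hpa : τ p = a := by
    by_contra hpa
    exact hp ((toward_eq_toward_of_adj hτ.isTree hadj hpa hqa).trans hq)
  refine ⟨p, q, hpq, hpa, ?_, hpI, hqI⟩
  rw [← hq, toward_of_adj hτ.isTree (hpa ▸ hadj)]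

theorem exists_gromovProduct_le (hτ : TreeOfGraphs Γ T τ N δ) {a b : W} (hab : T.Adj a b) (o : X) :
    ∃ C : ℝ, ∀ x y, toward T a (τ x) ≠ b → toward T a (τ y) = b →
      gromovProduct Γ o x y ≤ C := by
  obtain ⟨x₀, y₀, hx₀, hy₀, hadj₀⟩ := hτ.exists_adj hab
  refine ⟨Γ.dist o x₀ + N, fun x y hx hy => ?_⟩
  obtain ⟨p, q, hpq, hp, hq, hpI, -⟩ := hτ.exists_crossing hab hx hy
  refine (gromovProduct_le_dist_of_mem hτ.connected hpI).trans ?_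
  have hfib := hτ.adhesion hadj₀ hpq (hx₀.trans hp.symm) (hy₀.trans hq.symm)
    (by rw [hx₀, hy₀]; exact hab.ne)
  have hx₀p := hτ.dist_le_fibre_dist (hx₀.trans hp.symm)
  have htri := hτ.connected.dist_triangle (u := o) (v := x₀) (w := p)
  exact_mod_cast (by omega : Γ.dist o p ≤ Γ.dist o x₀ + N)

theorem exists_isGate (hτ : TreeOfGraphs Γ T τ N δ) : ∃ gate, IsGate Γ T τ gate := by
  classical
  have := hτ.nonempty
  have hex (a b : W) (hab : T.Adj a b) := hτ.exists_adj hab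
  choose! p q hp hq hpq using hex
  let _ : LinearOrder W := linearOrderOfSTO WellOrderingRel
  refine ⟨fun a b => if a < b then p a b else q b a, fun a b hab => ?_⟩
  rcases hab.ne.lt_or_gt with hlt | hlt <;> simp only [hlt, hlt.not_gt, if_true, if_false]
  · exact ⟨hp a b hab, hpq a b hab⟩
  · exact ⟨hq b a hab.symm, (hpq b a hab.symm).symm⟩

end TreeOfGraphs

lemma gateProj_of_eq {t : W} {x : X} (hx : τ x = t) : gateProj T τ gate t x = x := if_pos hx

lemma gateProj_of_ne {t : W} {x : X} (hx : τ x ≠ t) :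
    gateProj T τ gate t x = gate t (toward T t (τ x)) := if_neg hx

lemma gateProj_congr (hT : T.IsTree) {t : W} {x y : X} (hx : τ x ≠ t)
    (hxy : toward T t (τ x) = toward T t (τ y)) :
    gateProj T τ gate t x = gateProj T τ gate t y := by
  have hy : τ y ≠ t := fun hy =>
    hx ((toward_eq_self_iff hT).1 (hxy.trans ((toward_eq_self_iff hT).2 hy)))
  rw [gateProj_of_ne hx, gateProj_of_ne hy, hxy]

lemma IsGate.apply_gateProj (hT : T.IsTree) (hg : IsGate Γ T τ gate) (t : W) (x : X) :
    τ (gateProj T τ gate t x) = t := by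
  by_cases hx : τ x = t
  · rw [gateProj_of_eq hx, hx]
  · rw [gateProj_of_ne hx]
    exact (hg _ _ (toward_spec hT hx).1).1

lemma gatePath_comm (x y : X) : gatePath Γ T τ gate x y = gatePath Γ T τ gate y x :=
  Set.ext fun _ => and_congr mem_interval_comm mem_interval_comm

namespace TreeOfGraphs

lemma fibre_dist_gate_le (hτ : TreeOfGraphs Γ T τ N δ) (hg : IsGate Γ T τ gate) {x y : X}
    (hxy : Γ.Adj x y) (hne : τ x ≠ τ y) : (fibreGraph Γ τ).dist x (gate (τ x) (τ y)) ≤ N := by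
  have hadj := (hτ.adj hxy).resolve_left hne
  exact hτ.adhesion hxy (hg _ _ hadj).2 (hg _ _ hadj).1.symm (hg _ _ hadj.symm).1.symm hne

lemma fibre_dist_gateProj_le_of_adj (hτ : TreeOfGraphs Γ T τ N δ) (hg : IsGate Γ T τ gate) (t : W)
    {x y : X} (hxy : Γ.Adj x y) :
    (fibreGraph Γ τ).dist (gateProj T τ gate t x) (gateProj T τ gate t y) ≤ N + 1 := by
  have hone {x y : X} (hxy : Γ.Adj x y) (hx : τ x = t) (hy : τ y ≠ t) :
      (fibreGraph Γ τ).dist (gateProj T τ gate t x) (gateProj T τ gate t y) ≤ N + 1 := by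
    subst hx
    rw [gateProj_of_eq rfl, gateProj_of_ne hy,
      toward_of_adj hτ.isTree ((hτ.adj hxy).resolve_left hy.symm)]
    exact (hτ.fibre_dist_gate_le hg hxy hy.symm).trans (Nat.le_succ N)
  by_cases hx : τ x = t <;> by_cases hy : τ y = t
  · rw [gateProj_of_eq hx, gateProj_of_eq hy, SimpleGraph.dist_eq_one_iff_adj.2
      (show (fibreGraph Γ τ).Adj x y from ⟨hxy, hx.trans hy.symm⟩)]
    omega
  · exact hone hxy hx hy
  · exact SimpleGraph.dist_comm.trans_le (hone hxy.symm hy hx)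
  · have hdir : toward T t (τ x) = toward T t (τ y) := by
      rcases hτ.adj hxy with h | h
      · rw [h]
      · exact toward_eq_toward_of_adj hτ.isTree h hx hy
    simp [gateProj_congr hτ.isTree hx hdir]

theorem fibre_dist_gateProj_le (hτ : TreeOfGraphs Γ T τ N δ) (hg : IsGate Γ T τ gate) (t : W)
    (x y : X) :
    (fibreGraph Γ τ).dist (gateProj T τ gate t x) (gateProj T τ gate t y) ≤
      (N + 1) * Γ.dist x y := by
  refine le_mul_dist_of_adj hτ.connected
    (d := fun x y => (fibreGraph Γ τ).dist (gateProj T τ gate t x) (gateProj T τ gate t y))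
    (by simp) (fun x y z => hτ.fibre_dist_triangle ?_)
    (fun x y hxy => hτ.fibre_dist_gateProj_le_of_adj hg t hxy) x y
  rw [hg.apply_gateProj hτ.isTree, hg.apply_gateProj hτ.isTree]

theorem fibre_dist_le (hτ : TreeOfGraphs Γ T τ N δ) {x y : X} (hxy : τ x = τ y) :
    (fibreGraph Γ τ).dist x y ≤ (N + 1) * Γ.dist x y := by
  obtain ⟨gate, hg⟩ := hτ.exists_isGate
  simpa only [gateProj_of_eq rfl, gateProj_of_eq hxy.symm] using
    hτ.fibre_dist_gateProj_le hg (τ x) x y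

lemma exists_walk_mem_interval_fibre (hτ : TreeOfGraphs Γ T τ N δ) {x y : X} (hxy : τ x = τ y) :
    ∃ P : Γ.Walk x y, ∀ w ∈ P.support, τ w = τ x ∧ w ∈ interval (fibreGraph Γ τ) x y := by
  classical
  obtain ⟨P, hP⟩ := (hτ.reachable hxy).exists_walk_length_eq_dist
  refine ⟨P.mapLe fibreGraph_le, fun w hw => ?_⟩
  have hw : w ∈ P.support := by simpa using hw
  exact ⟨(eq_of_reachable_fibreGraph (P.takeUntil w hw).reachable).symm,
    (show IsShortest P from hP).mem_interval hw⟩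

lemma mem_gatePath_of_mem_interval_fibre {x y w : X} (hw : τ w = τ x)
    (hwI : w ∈ interval (fibreGraph Γ τ) x (gateProj T τ gate (τ x) y)) :
    w ∈ gatePath Γ T τ gate x y := by
  refine ⟨hw ▸ left_mem_interval _ _, ?_⟩
  rwa [gateProj_of_eq hw.symm, hw]

lemma gatePath_gate_subset (hτ : TreeOfGraphs Γ T τ N δ) (hg : IsGate Γ T τ gate) {x y : X}
    (hxy : τ y ≠ τ x) :
    gatePath Γ T τ gate (gate (toward T (τ x) (τ y)) (τ x)) y ⊆ gatePath Γ T τ gate x y := by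
  rintro w ⟨hw, hwI⟩
  obtain ⟨hadj, hmem⟩ := toward_spec hτ.isTree hxy
  have hdist := dist_toward hτ.isTree hxy
  set b := toward T (τ x) (τ y)
  have hb : τ (gate b (τ x)) = b := (hg _ _ hadj.symm).1
  rw [hb] at hw
  refine ⟨(mem_interval_trans hτ.isTree.1 hmem hw).1, ?_⟩
  have hwx : τ x ≠ τ w := by
    intro hxw
    rw [← hxw, mem_interval] at hw
    omega
  suffices gateProj T τ gate (τ w) x = gateProj T τ gate (τ w) (gate b (τ x)) by rwa [this]
  by_cases hwb : τ w = b
  · rw [gateProj_of_ne hwx, gateProj_of_eq (hb.trans hwb.symm), hwb,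
      toward_of_adj hτ.isTree hadj.symm]
  · refine gateProj_congr hτ.isTree hwx ?_
    rw [hb]
    exact toward_eq_toward_of_adj hτ.isTree hadj hwx (Ne.symm hwb)

theorem exists_walk_gatePath (hτ : TreeOfGraphs Γ T τ N δ) (hg : IsGate Γ T τ gate) (x y : X) :
    ∃ P : Γ.Walk x y, ∀ w ∈ P.support, w ∈ gatePath Γ T τ gate x y := by
  induction hn : T.dist (τ x) (τ y) generalizing x with
  | zero =>
    have hxy : τ x = τ y := hτ.isTree.1.dist_eq_zero_iff.1 hn
    obtain ⟨P, hP⟩ := hτ.exists_walk_mem_interval_fibre hxy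
    refine ⟨P, fun w hw => mem_gatePath_of_mem_interval_fibre (hP w hw).1 ?_⟩
    rw [gateProj_of_eq hxy.symm]
    exact (hP w hw).2
  | succ n ih =>
    have hxy : τ y ≠ τ x := fun h => by simp [h] at hn
    have hadj := (toward_spec hτ.isTree hxy).1
    have hdist := dist_toward hτ.isTree hxy
    obtain ⟨hgate, hcross⟩ := hg _ _ hadj
    obtain ⟨P, hP⟩ := hτ.exists_walk_mem_interval_fibre hgate.symm
    obtain ⟨Q, hQ⟩ := ih (gate (toward T (τ x) (τ y)) (τ x)) (by
      rw [(hg _ _ hadj.symm).1]; omega)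
    have hP' (w : X) (hw : w ∈ P.support) : w ∈ gatePath Γ T τ gate x y := by
      refine mem_gatePath_of_mem_interval_fibre (hP w hw).1 ?_
      rw [gateProj_of_ne hxy]
      exact (hP w hw).2
    refine ⟨P.append (Q.cons hcross), fun w hw => ?_⟩
    rw [SimpleGraph.Walk.mem_support_append_iff, SimpleGraph.Walk.support_cons,
      List.mem_cons] at hw
    rcases hw with hw | rfl | hw
    · exact hP' w hw
    · exact hP' _ P.end_mem_support
    · exact hτ.gatePath_gate_subset hg hxy (hQ w hw)

lemma mem_gatePath_of_toward_eq (hτ : TreeOfGraphs Γ T τ N δ) {x y z w : X}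
    (hw : w ∈ gatePath Γ T τ gate x y) (hx : τ x ≠ τ w)
    (hxz : toward T (τ w) (τ x) = toward T (τ w) (τ z)) : w ∈ gatePath Γ T τ gate z y := by
  obtain ⟨hwT, hwI⟩ := hw
  refine ⟨?_, by rwa [← gateProj_congr hτ.isTree hx hxz]⟩
  rw [mem_interval_iff_toward hτ.isTree] at hwT ⊢
  exact fun hzy => absurd (hwT (hxz.trans hzy)) hx

theorem gatePath_thin (hτ : TreeOfGraphs Γ T τ N δ) (hg : IsGate Γ T τ gate) (x y z w : X)
    (hw : w ∈ gatePath Γ T τ gate x y) :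
    ∃ w', (w' ∈ gatePath Γ T τ gate x z ∨ w' ∈ gatePath Γ T τ gate z y) ∧ Γ.dist w w' ≤ δ := by
  by_cases hxz : τ x ≠ τ w ∧ toward T (τ w) (τ x) = toward T (τ w) (τ z)
  · exact ⟨w, Or.inr (hτ.mem_gatePath_of_toward_eq hw hxz.1 hxz.2), by simp⟩
  by_cases hyz : τ y ≠ τ w ∧ toward T (τ w) (τ y) = toward T (τ w) (τ z)
  · refine ⟨w, Or.inl ?_, by simp⟩
    rw [gatePath_comm] at hw ⊢
    exact hτ.mem_gatePath_of_toward_eq hw hyz.1 hyz.2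
  -- Now the directions of `x`, `y`, `z` at `τ w` are distinct, and the projections of the three
  -- points to the fibre of `w` form a triangle there.
  have hx := hg.apply_gateProj hτ.isTree (τ w) x
  have hy := hg.apply_gateProj hτ.isTree (τ w) y
  have hz := hg.apply_gateProj hτ.isTree (τ w) z
  obtain ⟨w', hww', hw', hd⟩ := hτ.thin (hy.trans hx.symm) (hz.trans hx.symm) hx.symm hw.2
  rw [hx] at hww'
  refine ⟨w', ?_, (hτ.dist_le_fibre_dist hww'.symm).trans hd⟩
  rw [← hww'] at hxz hyz hw'
  refine hw'.imp (fun hw' => ⟨?_, hw'⟩) (fun hw' => ⟨?_, hw'⟩)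
  · rw [mem_interval_iff_toward hτ.isTree]
    exact fun h => not_not.1 fun hne => hxz ⟨hne, h⟩
  · rw [mem_interval_comm, mem_interval_iff_toward hτ.isTree]
    exact fun h => not_not.1 fun hne => hyz ⟨hne, h⟩

lemma dist_gateProj_le_of_mem_gatePath (hτ : TreeOfGraphs Γ T τ N δ) (hg : IsGate Γ T τ gate)
    {x y w : X} (hw : w ∈ gatePath Γ T τ gate x y) :
    Γ.dist (gateProj T τ gate (τ w) x) w ≤ (N + 1) * Γ.dist x y :=
  calc Γ.dist (gateProj T τ gate (τ w) x) w
      ≤ (fibreGraph Γ τ).dist (gateProj T τ gate (τ w) x) w :=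
        hτ.dist_le_fibre_dist (hg.apply_gateProj hτ.isTree _ _)
    _ ≤ (fibreGraph Γ τ).dist (gateProj T τ gate (τ w) x) (gateProj T τ gate (τ w) y) := by
        rw [← mem_interval.1 hw.2]; omega
    _ ≤ (N + 1) * Γ.dist x y := hτ.fibre_dist_gateProj_le hg _ _ _

lemma dist_le_of_mem_gatePath (hτ : TreeOfGraphs Γ T τ N δ) (hg : IsGate Γ T τ gate) {x y w : X}
    (hxy : Γ.dist x y ≤ 1) (hw : w ∈ gatePath Γ T τ gate x y) : Γ.dist x w ≤ N + 2 := by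
  have hends : τ w = τ x ∨ τ w = τ y := by
    by_cases hd : T.dist (τ x) (τ y) = 0
    · exact Or.inl (eq_of_mem_interval_self hτ.isTree.1
        (hτ.isTree.1.dist_eq_zero_iff.1 hd ▸ hw.1))
    · have := hτ.tree_dist_le x y
      exact eq_or_eq_of_mem_interval_of_adj hτ.isTree.1
        (SimpleGraph.dist_eq_one_iff_adj.1 (by omega)) hw.1
  have hle := Nat.mul_le_mul_left (N + 1) hxy
  rcases hends with hwx | hwy
  · have hdist := hτ.dist_gateProj_le_of_mem_gatePath hg hw
    rw [gateProj_of_eq hwx.symm] at hdist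
    omega
  · have hdist := hτ.dist_gateProj_le_of_mem_gatePath hg (gatePath_comm x y ▸ hw)
    rw [gateProj_of_eq hwy.symm, Γ.dist_comm (u := y) (v := x)] at hdist
    have htri := hτ.connected.dist_triangle (u := x) (v := y) (w := w)
    omega

theorem guessedGeodesics (hτ : TreeOfGraphs Γ T τ N δ) (hg : IsGate Γ T τ gate) :
    GuessedGeodesics Γ (gatePath Γ T τ gate) (δ + N + 2) where
  exists_walk := hτ.exists_walk_gatePath hg
  thin x y z w hw := by
    obtain ⟨w', hw', hd⟩ := hτ.gatePath_thin hg x y z w hw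
    exact ⟨w', hw', by omega⟩
  small x y w hd hw := by
    rw [Γ.dist_comm]
    exact (hτ.dist_le_of_mem_gatePath hg hd hw).trans (by omega)

end TreeOfGraphs

end TreeOfGraphs

/-! ### Induced maps between boundaries -/

section BoundaryMap

variable {X Y : Type*} {Γ : SimpleGraph X} {Δ : SimpleGraph Y} {ι : Y → X} {δ ε : ℕ}

/-- Gromov products in `Δ` can be large only if those of the images under `ι` in `Γ` are. This is
what `ι` needs in order to map sequences that converge to a common boundary point to sequences with
that property. -/
def IsGromovProper (Δ : SimpleGraph Y) (Γ : SimpleGraph X) (ι : Y → X) : Prop :=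
  ∃ C : ℝ, 0 < C ∧ ∀ o a b,
    gromovProduct Δ o a b ≤ C * gromovProduct Γ (ι o) (ι a) (ι b) + C

/-- The map `F` between the boundaries is induced by the map `ι` between the vertex sets: it is the
extension of `ι` that is continuous along sequences of vertices. -/
def Induces (ι : Y → X) (F : Boundary Δ → Boundary Γ) : Prop :=
  ∀ x η, ConvergesTo Δ x η → ConvergesTo Γ (ι ∘ x) (F η)

lemma IsGromovProper.exists_forall_le (hι : IsGromovProper Δ Γ ι) (M : ℝ) :
    ∃ M' : ℝ, ∀ o a b, M' ≤ gromovProduct Δ o a b → M ≤ gromovProduct Γ (ι o) (ι a) (ι b) := by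
  obtain ⟨C, hC, hle⟩ := hι
  refine ⟨C * M + C, fun o a b h => le_of_mul_le_mul_left ?_ hC⟩
  linarith [hle o a b]

lemma IsGromovProper.isGromovSequence (hι : IsGromovProper Δ Γ ι) (hΓ : Γ.Connected) {x : ℕ → Y}
    (hx : IsGromovSequence Δ x) : IsGromovSequence Γ (ι ∘ x) := by
  refine .of_base hΓ (ι (x 0)) fun M => ?_
  obtain ⟨M', hM'⟩ := hι.exists_forall_le M
  obtain ⟨n, hn⟩ := hx.exists_forall_ge (x 0) M'
  exact ⟨n, fun i hi j hj => hM' _ _ _ (hn i hi j hj)⟩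

lemma IsGromovProper.coConvergent (hι : IsGromovProper Δ Γ ι) (hΓ : Γ.Connected) {x y : ℕ → Y}
    (hxy : CoConvergent Δ x y) : CoConvergent Γ (ι ∘ x) (ι ∘ y) := by
  refine .of_base hΓ (ι (x 0)) (tendsto_atTop.2 fun M => ?_)
  obtain ⟨M', hM'⟩ := hι.exists_forall_le M
  exact ((hxy (x 0)).eventually_ge_atTop M').mono fun i => hM' _ _ _

theorem IsGromovProper.exists_induces (hι : IsGromovProper Δ Γ ι) (hΓ : Γ.Connected)
    (hΔ : Δ.Connected) (hδ : ThinIntervals Γ δ) (hε : ThinIntervals Δ ε)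
    (hrays : ∀ r : GeodesicRay Δ, ∃ s : GeodesicRay Γ, CoConvergent Γ (ι ∘ r.vertex) s.vertex) :
    ∃ F : Boundary Δ → Boundary Γ, Induces ι F := by
  choose s hs using hrays
  choose r hr using exists_point_eq (Γ := Δ)
  refine ⟨fun η => (s (r η)).point, fun x η hx => (convergesTo_iff hΓ hδ).2 ?_⟩
  rw [← hr η, convergesTo_iff hΔ hε] at hx
  exact (hι.coConvergent hΓ hx).trans (hδ.fourPoint hΓ) (hs _)

lemma GeodesicRay.convergesTo_point (hΓ : Γ.Connected) (hδ : ThinIntervals Γ δ)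
    (r : GeodesicRay Γ) : ConvergesTo Γ r.vertex r.point :=
  (convergesTo_iff hΓ hδ).2 (r.isGromovSequence hΓ).coConvergent_self

theorem ConvergesTo.unique (hΓ : Γ.Connected) (hδ : ThinIntervals Γ δ) {x : ℕ → X}
    {ξ η : Boundary Γ} (hξ : ConvergesTo Γ x ξ) (hη : ConvergesTo Γ x η) : ξ = η := by
  obtain ⟨r, rfl⟩ := exists_point_eq ξ
  obtain ⟨s, rfl⟩ := exists_point_eq η
  rw [convergesTo_iff hΓ hδ] at hξ hη
  exact (GeodesicRay.point_eq_iff hΓ (hδ.fourPoint hΓ)).2 (hξ.symm.trans (hδ.fourPoint hΓ) hη)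

lemma near_self (hΓ : Γ.Connected) (o : X) (n : ℕ) (ξ : Boundary Γ) : Near Γ o n ξ ξ := by
  obtain ⟨r, rfl⟩ := exists_point_eq ξ
  exact ⟨r, r, rfl, rfl, (r.isGromovSequence hΓ).exists_forall_ge o n⟩

lemma isOpen_boundary_iff {O : Set (Boundary Γ)} :
    IsOpen O ↔ ∀ ξ ∈ O, ∀ o : X, ∃ n : ℕ, ∀ η, Near Γ o n ξ η → η ∈ O := Iff.rfl

variable {F : Boundary Δ → Boundary Γ}

lemma Induces.coConvergent (hF : Induces ι F) (hΓ : Γ.Connected) (hΔ : Δ.Connected)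
    (hδ : ThinIntervals Γ δ) (hε : ThinIntervals Δ ε) {r : GeodesicRay Δ} {s : GeodesicRay Γ}
    (hs : s.point = F r.point) : CoConvergent Γ (ι ∘ r.vertex) s.vertex :=
  (convergesTo_iff hΓ hδ).1 (hs ▸ hF r.vertex r.point (r.convergesTo_point hΔ hε))

theorem Induces.continuous (hF : Induces ι F) (hι : IsGromovProper Δ Γ ι) (hΓ : Γ.Connected)
    (hΔ : Δ.Connected) (hδ : ThinIntervals Γ δ) (hε : ThinIntervals Δ ε) : Continuous F := by
  refine continuous_def.2 fun O hO => isOpen_boundary_iff.2 fun η hη o => ?_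
  obtain ⟨n, hn⟩ := isOpen_boundary_iff.1 hO (F η) hη (ι o)
  obtain ⟨M, hM⟩ := hι.exists_forall_le (n + 4 * (3 * δ + 1))
  refine ⟨⌈M + 2 * (3 * ε + 1)⌉₊, fun η' hnear => hn _ ?_⟩
  obtain ⟨r, rfl⟩ := exists_point_eq η
  obtain ⟨r', rfl⟩ := exists_point_eq η'
  obtain ⟨s, hs⟩ := exists_point_eq (F r.point)
  obtain ⟨s', hs'⟩ := exists_point_eq (F r'.point)
  rw [← hs, ← hs']
  refine near_of_eventually_le hΓ (hδ.fourPoint hΓ) (hF.coConvergent hΓ hΔ hδ hε hs)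
    (hF.coConvergent hΓ hΔ hδ hε hs') ?_
  filter_upwards [hnear.eventually_le hΔ (hε.fourPoint hΔ)
    (r.isGromovSequence hΔ).coConvergent_self (r'.isGromovSequence hΔ).coConvergent_self] with i hi
  exact hM _ _ _ (by linarith [Nat.le_ceil (M + 2 * (3 * ε + 1))])

section Expanding

variable {C : ℝ}

theorem Induces.injective (hF : Induces ι F)
    (hle : ∀ o a b, gromovProduct Γ (ι o) (ι a) (ι b) ≤ gromovProduct Δ o a b + C)
    (hΓ : Γ.Connected) (hΔ : Δ.Connected) (hδ : ThinIntervals Γ δ) (hε : ThinIntervals Δ ε) :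
    Function.Injective F := by
  intro η η' h
  obtain ⟨r, rfl⟩ := exists_point_eq η
  obtain ⟨r', rfl⟩ := exists_point_eq η'
  obtain ⟨s, hs⟩ := exists_point_eq (F r.point)
  have hco := (hF.coConvergent hΓ hΔ hδ hε hs).trans (hδ.fourPoint hΓ)
    (hF.coConvergent hΓ hΔ hδ hε (hs.trans h)).symm
  refine (GeodesicRay.point_eq_iff hΔ (hε.fourPoint hΔ)).2 (.of_base hΔ (r.vertex 0) ?_)
  refine tendsto_atTop_mono (fun i => ?_)
    (tendsto_atTop_add_const_right _ (-C) (hco (ι (r.vertex 0))))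
  simp only [Function.comp_apply]
  linarith [hle (r.vertex 0) (r.vertex i) (r'.vertex i)]

theorem Induces.exists_near (hF : Induces ι F)
    (hle : ∀ o a b, gromovProduct Γ (ι o) (ι a) (ι b) ≤ gromovProduct Δ o a b + C)
    (hΓ : Γ.Connected) (hΔ : Δ.Connected) (hδ : ThinIntervals Γ δ) (hε : ThinIntervals Δ ε)
    (o : Y) (n : ℕ) : ∃ m, ∀ η η', Near Γ (ι o) m (F η) (F η') → Near Δ o n η η' := by
  refine ⟨⌈n + 4 * (3 * ε + 1) + C + 2 * (3 * δ + 1)⌉₊, fun η η' hnear => ?_⟩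
  obtain ⟨r, rfl⟩ := exists_point_eq η
  obtain ⟨r', rfl⟩ := exists_point_eq η'
  obtain ⟨s, hs⟩ := exists_point_eq (F r.point)
  obtain ⟨s', hs'⟩ := exists_point_eq (F r'.point)
  rw [← hs, ← hs'] at hnear
  refine near_of_eventually_le hΔ (hε.fourPoint hΔ) (r.isGromovSequence hΔ).coConvergent_self
    (r'.isGromovSequence hΔ).coConvergent_self ?_
  filter_upwards [hnear.eventually_le hΓ (hδ.fourPoint hΓ) (hF.coConvergent hΓ hΔ hδ hε hs)
    (hF.coConvergent hΓ hΔ hδ hε hs')] with i hi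
  simp only [Function.comp_apply] at hi
  linarith [hle o (r.vertex i) (r'.vertex i),
    Nat.le_ceil (n + 4 * (3 * ε + 1) + C + 2 * (3 * δ + 1))]

theorem Induces.isClosedMap (hF : Induces ι F)
    (hle : ∀ o a b, gromovProduct Γ (ι o) (ι a) (ι b) ≤ gromovProduct Δ o a b + C)
    (hΓ : Γ.Connected) (hΔ : Δ.Connected) (hδ : ThinIntervals Γ δ) (hε : ThinIntervals Δ ε)
    (hrange : IsClosed (Set.range F)) : IsClosedMap F := by
  intro K hK
  rw [← isOpen_compl_iff, isOpen_boundary_iff]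
  intro ξ hξ o
  by_cases hmem : ξ ∈ Set.range F
  · obtain ⟨η, rfl⟩ := hmem
    obtain ⟨o'⟩ := hΔ.nonempty
    have hη : η ∈ Kᶜ := fun h => hξ ⟨η, h, rfl⟩
    obtain ⟨n, hn⟩ := isOpen_boundary_iff.1 hK.isOpen_compl η hη o'
    obtain ⟨m, hm⟩ := hF.exists_near hle hΓ hΔ hδ hε o' n
    refine ⟨m + Γ.dist o (ι o'), ?_⟩
    rintro _ hnear ⟨η', hη', rfl⟩
    exact hn η' (hm η η' (hnear.base_change hΓ le_rfl)) hη'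
  · obtain ⟨n, hn⟩ := isOpen_boundary_iff.1 hrange.isOpen_compl ξ hmem o
    refine ⟨n, ?_⟩
    rintro _ hnear ⟨η', -, rfl⟩
    exact hn _ hnear ⟨η', rfl⟩

end Expanding

end BoundaryMap
/-! ### Pieces of a tree of graphs -/

section Pieces

variable {X Y W : Type*} {Γ : SimpleGraph X} {Δ : SimpleGraph Y} {T : SimpleGraph W} {τ : X → W}
  {N δ : ℕ} {t : W} {ι : Δ ↪g Γ} {gate : W → W → X}

/-- The embedding `ι` identifies the graph `Δ` with the fibre of `τ` over `t`. -/
def IsPiece (τ : X → W) (t : W) (ι : Δ ↪g Γ) : Prop := Set.range ι = τ ⁻¹' {t}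

namespace IsPiece

lemma apply_eq (hι : IsPiece τ t ι) (a : Y) : τ (ι a) = t :=
  (Set.ext_iff.1 hι (ι a)).1 ⟨a, rfl⟩

lemma exists_apply_eq (hι : IsPiece τ t ι) {x : X} (hx : τ x = t) : ∃ a, ι a = x :=
  (Set.ext_iff.1 hι x).2 hx

lemma adj_iff (hι : IsPiece τ t ι) {a b : Y} : (fibreGraph Γ τ).Adj (ι a) (ι b) ↔ Δ.Adj a b :=
  (and_iff_left ((hι.apply_eq a).trans (hι.apply_eq b).symm)).trans ι.map_rel_iff

lemma exists_walk_fibre (hι : IsPiece τ t ι) {a b : Y} (P : Δ.Walk a b) :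
    ∃ Q : (fibreGraph Γ τ).Walk (ι a) (ι b), Q.length = P.length :=
  ⟨P.map ⟨ι, hι.adj_iff.2⟩, P.length_map _⟩

lemma exists_walk_of_fibre (hι : IsPiece τ t ι) {x y : X} (P : (fibreGraph Γ τ).Walk x y) :
    ∀ a b, ι a = x → ι b = y → ∃ Q : Δ.Walk a b, Q.length = P.length := by
  induction P with
  | nil =>
    intro a b ha hb
    obtain rfl := ι.injective (ha.trans hb.symm)
    exact ⟨.nil, rfl⟩
  | @cons u v w huv P ih =>
    rintro a b rfl hb
    obtain ⟨a', rfl⟩ := hι.exists_apply_eq (huv.2.symm.trans (hι.apply_eq a))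
    obtain ⟨Q, hQ⟩ := ih a' b rfl hb
    exact ⟨Q.cons (hι.adj_iff.1 huv), by simp [hQ]⟩

lemma dist_eq (hι : IsPiece τ t ι) (hΔ : Δ.Connected) (a b : Y) :
    (fibreGraph Γ τ).dist (ι a) (ι b) = Δ.dist a b := by
  obtain ⟨P, hP⟩ := hΔ.exists_walk_length_eq_dist a b
  obtain ⟨P', hP'⟩ := hι.exists_walk_fibre P
  obtain ⟨Q, hQ⟩ := P'.reachable.exists_walk_length_eq_dist
  obtain ⟨Q', hQ'⟩ := hι.exists_walk_of_fibre Q a b rfl rfl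
  have hle := SimpleGraph.dist_le P'
  have hge := SimpleGraph.dist_le Q'
  omega

lemma mem_interval_iff (hι : IsPiece τ t ι) (hΔ : Δ.Connected) {a b w : Y} :
    ι w ∈ interval (fibreGraph Γ τ) (ι a) (ι b) ↔ w ∈ interval Δ a b := by
  simp only [mem_interval, hι.dist_eq hΔ]

lemma reachable (hι : IsPiece τ t ι) (hΔ : Δ.Connected) {x y : X} (hx : τ x = t)
    (hy : τ y = t) : (fibreGraph Γ τ).Reachable x y := by
  obtain ⟨a, rfl⟩ := hι.exists_apply_eq hx
  obtain ⟨b, rfl⟩ := hι.exists_apply_eq hy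
  obtain ⟨P⟩ := hΔ.preconnected a b
  obtain ⟨Q, -⟩ := hι.exists_walk_fibre P
  exact Q.reachable

lemma thin (hι : IsPiece τ t ι) (hΔ : Δ.Connected) (hδ : ThinIntervals Δ δ) {x y z w : X}
    (hx : τ x = t) (hy : τ y = t) (hz : τ z = t) (hw : τ w = t)
    (hwxy : w ∈ interval (fibreGraph Γ τ) x y) :
    ∃ w', τ w' = t ∧ (w' ∈ interval (fibreGraph Γ τ) x z ∨ w' ∈ interval (fibreGraph Γ τ) z y) ∧
      (fibreGraph Γ τ).dist w w' ≤ δ := by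
  obtain ⟨a, rfl⟩ := hι.exists_apply_eq hx
  obtain ⟨b, rfl⟩ := hι.exists_apply_eq hy
  obtain ⟨c, rfl⟩ := hι.exists_apply_eq hz
  obtain ⟨d, rfl⟩ := hι.exists_apply_eq hw
  obtain ⟨d', hd', hdist⟩ := hδ a b c d ((hι.mem_interval_iff hΔ).1 hwxy)
  refine ⟨ι d', hι.apply_eq d', ?_, by rwa [hι.dist_eq hΔ]⟩
  rwa [hι.mem_interval_iff hΔ, hι.mem_interval_iff hΔ]

lemma finite (hι : IsPiece τ t ι) (hΔ : Δ.Connected) (hfin : IsLocallyFinite Δ) {x : X}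
    (hx : τ x = t) (n : ℕ) : {y | τ y = t ∧ (fibreGraph Γ τ).dist x y ≤ n}.Finite := by
  obtain ⟨a, rfl⟩ := hι.exists_apply_eq hx
  refine ((finite_setOf_dist_le hΔ hfin a n).image ι).subset ?_
  rintro y ⟨hy, hd⟩
  obtain ⟨b, rfl⟩ := hι.exists_apply_eq hy
  rw [hι.dist_eq hΔ, Δ.dist_comm] at hd
  exact ⟨b, hd, rfl⟩

end IsPiece

namespace TreeOfGraphs

theorem thinIntervals (hτ : TreeOfGraphs Γ T τ N δ) : ∃ ε, ThinIntervals Γ ε :=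
  let ⟨_, hg⟩ := hτ.exists_isGate
  ⟨_, (hτ.guessedGeodesics hg).thinIntervals hτ.connected⟩

theorem exists_mem_gatePath_dist_le (hτ : TreeOfGraphs Γ T τ N δ) (hg : IsGate Γ T τ gate) :
    ∃ K : ℝ, 0 ≤ K ∧ ∀ o x y, ∃ w ∈ gatePath Γ T τ gate x y,
      (Γ.dist o w : ℝ) ≤ gromovProduct Γ o x y + K := by
  obtain ⟨ε, hε⟩ := hτ.thinIntervals
  refine ⟨2 * ε + 1 + (3 * (150 * (δ + N + 2) ^ 2) + 1), by positivity, fun o x y => ?_⟩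
  obtain ⟨v, hv, hov⟩ := hε.exists_dist_le hτ.connected o x y
  obtain ⟨w, hw, hvw⟩ := (hτ.guessedGeodesics hg).exists_mem_dist_le hτ.connected hv
  have hvw : (Γ.dist v w : ℝ) ≤ 3 * (150 * (δ + N + 2) ^ 2) + 1 := by exact_mod_cast hvw
  exact ⟨w, hw, by linarith [cast_dist_triangle hτ.connected o v w]⟩

theorem tree_gromovProduct_le (hτ : TreeOfGraphs Γ T τ N δ) : ∃ C : ℝ, 0 ≤ C ∧ ∀ o x y,
    gromovProduct T (τ o) (τ x) (τ y) ≤ gromovProduct Γ o x y + C := by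
  obtain ⟨gate, hg⟩ := hτ.exists_isGate
  obtain ⟨K, hK, hpath⟩ := hτ.exists_mem_gatePath_dist_le hg
  refine ⟨K, hK, fun o x y => ?_⟩
  obtain ⟨w, hw, how⟩ := hpath o x y
  calc gromovProduct T (τ o) (τ x) (τ y)
      ≤ T.dist (τ o) (τ w) := gromovProduct_le_dist_of_mem hτ.isTree.1 hw.1
    _ ≤ Γ.dist o w := by exact_mod_cast hτ.tree_dist_le o w
    _ ≤ gromovProduct Γ o x y + K := how

theorem isGromovProper_section (hτ : TreeOfGraphs Γ T τ N δ) {σ : W → X}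
    (hσ : Function.RightInverse σ τ) : IsGromovProper T Γ σ := by
  obtain ⟨C, hC, hle⟩ := hτ.tree_gromovProduct_le
  refine ⟨C + 1, by linarith, fun o a b => ?_⟩
  have hab := hle (σ o) (σ a) (σ b)
  rw [hσ, hσ, hσ] at hab
  linarith [mul_nonneg hC (gromovProduct_nonneg hτ.connected (σ o) (σ a) (σ b))]

lemma gatePath_piece (hτ : TreeOfGraphs Γ T τ N δ) (hι : IsPiece τ t ι) (hΔ : Δ.Connected)
    (a b : Y) : gatePath Γ T τ gate (ι a) (ι b) = ι '' interval Δ a b := by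
  ext w
  simp only [gatePath, Set.mem_ofPred_eq, hι.apply_eq, Set.mem_image]
  constructor
  · rintro ⟨hwt, hw⟩
    obtain ⟨c, rfl⟩ := hι.exists_apply_eq (eq_of_mem_interval_self hτ.isTree.1 hwt)
    rw [hι.apply_eq, gateProj_of_eq (hι.apply_eq a), gateProj_of_eq (hι.apply_eq b)] at hw
    exact ⟨c, (hι.mem_interval_iff hΔ).1 hw, rfl⟩
  · rintro ⟨c, hc, rfl⟩
    rw [hι.apply_eq, gateProj_of_eq (hι.apply_eq a), gateProj_of_eq (hι.apply_eq b)]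
    exact ⟨left_mem_interval t t, (hι.mem_interval_iff hΔ).2 hc⟩

theorem gromovProduct_piece_le (hτ : TreeOfGraphs Γ T τ N δ) (hι : IsPiece τ t ι)
    (hΔ : Δ.Connected) {ε : ℕ} (hε : ThinIntervals Δ ε) :
    ∃ C : ℝ, ∀ o a b, gromovProduct Γ (ι o) (ι a) (ι b) ≤ gromovProduct Δ o a b + C := by
  obtain ⟨gate, hg⟩ := hτ.exists_isGate
  refine ⟨2 * ε + 1 + 150 * (δ + N + 2) ^ 2, fun o a b => ?_⟩
  obtain ⟨w, hw, how⟩ := hε.exists_dist_le hΔ o a b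
  obtain ⟨v, hv, hwv⟩ := (hτ.guessedGeodesics hg).exists_mem_interval_dist_le hτ.connected
    (hτ.gatePath_piece hι hΔ a b ▸ Set.mem_image_of_mem ι hw)
  have hwv : (Γ.dist (ι w) v : ℝ) ≤ 150 * (δ + N + 2) ^ 2 := by exact_mod_cast hwv
  have hdist := hτ.dist_le_fibre_dist ((hι.apply_eq o).trans (hι.apply_eq w).symm)
  rw [hι.dist_eq hΔ] at hdist
  have hdist : (Γ.dist (ι o) (ι w) : ℝ) ≤ Δ.dist o w := by exact_mod_cast hdist
  linarith [gromovProduct_le_dist_of_mem hτ.connected (o := ι o) hv,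
    cast_dist_triangle hτ.connected (ι o) (ι w) v]

theorem isGromovProper_piece (hτ : TreeOfGraphs Γ T τ N δ) (hι : IsPiece τ t ι)
    (hΔ : Δ.Connected) : IsGromovProper Δ Γ ι := by
  obtain ⟨gate, hg⟩ := hτ.exists_isGate
  obtain ⟨K, hK, hpath⟩ := hτ.exists_mem_gatePath_dist_le hg
  refine ⟨(N + 1) * (K + 1), by positivity, fun o a b => ?_⟩
  obtain ⟨w, hw, how⟩ := hpath (ι o) (ι a) (ι b)
  rw [hτ.gatePath_piece hι hΔ] at hw
  obtain ⟨c, hc, rfl⟩ := hw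
  have hdist := hτ.fibre_dist_le ((hι.apply_eq o).trans (hι.apply_eq c).symm)
  rw [hι.dist_eq hΔ] at hdist
  have hnonneg := gromovProduct_nonneg hτ.connected (ι o) (ι a) (ι b)
  calc gromovProduct Δ o a b
      ≤ Δ.dist o c := gromovProduct_le_dist_of_mem hΔ hc
    _ ≤ (N + 1) * Γ.dist (ι o) (ι c) := by exact_mod_cast hdist
    _ ≤ (N + 1) * ((K + 1) * gromovProduct Γ (ι o) (ι a) (ι b) + (K + 1)) := by
      gcongr
      linarith [mul_nonneg hK hnonneg]
    _ = _ := by ring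

lemma exists_mem_interval_fibre (hτ : TreeOfGraphs Γ T τ N δ) (hg : IsGate Γ T τ gate)
    {y : X} (hy : τ y = t) (v : X) : ∃ v', τ v' = t ∧ v' ∈ interval Γ v y ∧
      (fibreGraph Γ τ).dist (gateProj T τ gate t v) v' ≤ N := by
  by_cases hv : τ v = t
  · exact ⟨v, hv, left_mem_interval v y, by simp [gateProj_of_eq hv]⟩
  · have hadj := (toward_spec hτ.isTree hv).1
    obtain ⟨p, q, hpq, rfl, hq, hp, -⟩ := hτ.exists_crossing (x := y) (y := v) hadj
      (by rw [hy, toward_self hτ.isTree]; exact hadj.ne) rfl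
    refine ⟨p, rfl, mem_interval_comm.1 hp, ?_⟩
    rw [gateProj_of_ne hv, ← hq, SimpleGraph.dist_comm]
    exact hτ.fibre_dist_gate_le hg hpq (hq ▸ hadj.ne)

lemma exists_ne_mem_interval_fibre (hτ : TreeOfGraphs Γ T τ N δ) (hg : IsGate Γ T τ gate)
    {v y : X} (hy : τ y = t) (hvy : v ≠ y) : ∃ v', τ v' = t ∧ v' ≠ v ∧ v' ∈ interval Γ v y ∧
      (fibreGraph Γ τ).dist (gateProj T τ gate t v) v' ≤ 2 * N + 1 := by
  obtain ⟨z, hvz, hz⟩ := exists_adj_mem_interval hτ.connected hvy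
  obtain ⟨v', hv', hv'I, hd⟩ := hτ.exists_mem_interval_fibre hg hy z
  refine ⟨v', hv', ?_, (mem_interval_trans hτ.connected hz hv'I).1, ?_⟩
  · rintro rfl
    rw [mem_interval] at hz hv'I
    have hpos := hτ.connected.pos_dist_of_ne hvz.ne
    omega
  · have hstep := hτ.fibre_dist_gateProj_le_of_adj hg t hvz
    have htri := hτ.fibre_dist_triangle (x := gateProj T τ gate t v) (z := v')
      ((hg.apply_gateProj hτ.isTree t v).trans (hg.apply_gateProj hτ.isTree t z).symm)
    omega

theorem exists_ray_of_fibre (hτ : TreeOfGraphs Γ T τ N δ) {y : ℕ → X}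
    (hy : IsGromovSequence Γ y) (hyt : ∀ n, τ (y n) = t) :
    ∃ s : GeodesicRay Γ, CoConvergent Γ y s.vertex := by
  obtain ⟨gate, hg⟩ := hτ.exists_isGate
  obtain ⟨ε, hε⟩ := hτ.thinIntervals
  obtain ⟨s, hs₀, hs⟩ := exists_ray_of_finite hτ.connected (y 0) y fun v => by
    refine ⟨_, hτ.finite (gateProj T τ gate t v) (2 * N + 1), ?_⟩
    filter_upwards [hy.coConvergent_self.eventually_ne v] with n hn
    obtain ⟨v', hv't, hne, hI, hd⟩ := hτ.exists_ne_mem_interval_fibre hg (hyt n) hn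
    exact ⟨v', ⟨hv't.trans (hg.apply_gateProj hτ.isTree t v).symm, hd⟩, hne, hI⟩
  exact ⟨s, coConvergent_of_frequently hτ.connected (hε.fourPoint hτ.connected) hy (hs₀ ▸ hs)⟩

lemma finite_setOf_exists_adj (hτ : TreeOfGraphs Γ T τ N δ) {a b : W} (hab : T.Adj a b) :
    {q | τ q = b ∧ ∃ p, τ p = a ∧ Γ.Adj q p}.Finite := by
  obtain ⟨x, y, rfl, rfl, hxy⟩ := hτ.exists_adj hab
  refine (hτ.finite y N).subset ?_
  rintro q ⟨hq, p, hp, hqp⟩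
  exact ⟨hq, hτ.adhesion hxy.symm hqp hq.symm hp.symm hab.ne'⟩

theorem exists_ray_of_tree_ray (hτ : TreeOfGraphs Γ T τ N δ) {y : ℕ → X}
    (hy : IsGromovSequence Γ y) (r : GeodesicRay T) (hyr : ∀ n, τ (y n) = r.vertex n) :
    ∃ s : GeodesicRay Γ, CoConvergent Γ y s.vertex := by
  obtain ⟨ε, hε⟩ := hτ.thinIntervals
  obtain ⟨s, hs₀, hs⟩ := exists_ray_of_finite hτ.connected (y 0) y fun v => by
    obtain ⟨m, hm⟩ := r.exists_toward_ne hτ.isTree (τ v)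
    refine ⟨_, hτ.finite_setOf_exists_adj (r.adj_succ m), ?_⟩
    filter_upwards [eventually_gt_atTop m] with n hn
    obtain ⟨p, q, hpq, hp, hq, -, hqI⟩ := hτ.exists_crossing (x := v) (y := y n) (r.adj_succ m) hm
      (by rw [hyr, r.toward_vertex hτ.isTree hn])
    refine ⟨q, ⟨hq, p, hp, hpq.symm⟩, ?_, hqI⟩
    rintro rfl
    exact hm (by rw [hq, toward_of_adj hτ.isTree (r.adj_succ m)])
  exact ⟨s, coConvergent_of_frequently hτ.connected (hε.fourPoint hτ.connected) hy (hs₀ ▸ hs)⟩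

theorem exists_piece_ray (hτ : TreeOfGraphs Γ T τ N δ) (hι : IsPiece τ t ι) (hΔ : Δ.Connected)
    (hfin : IsLocallyFinite Δ) {y : ℕ → Y} {s : GeodesicRay Γ}
    (hy : CoConvergent Γ (ι ∘ y) s.vertex) :
    ∃ r : GeodesicRay Δ, CoConvergent Γ (ι ∘ r.vertex) s.vertex := by
  obtain ⟨ε, hε⟩ := hτ.thinIntervals
  have hproper := hτ.isGromovProper_piece hι hΔ
  have h4 := hε.fourPoint hτ.connected
  obtain ⟨r, hr₀, hr⟩ := exists_ray_of_isLocallyFinite hΔ hfin (y 0) (y := y) fun v =>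
    (hy.symm.eventually_ne (ι v)).mono fun n => ne_of_apply_ne ι
  refine ⟨r, (hproper.isGromovSequence hτ.connected (r.isGromovSequence hΔ)).coConvergent
    hτ.connected h4 (s.isGromovSequence hτ.connected) (ι (y 0)) fun M n => ?_⟩
  obtain ⟨M', hM'⟩ := hproper.exists_forall_le (M + (3 * ε + 1))
  obtain ⟨j, hnj, hrj, hyj⟩ := frequently_atTop.1 ((hr (max ⌈M'⌉₊ n)).and_eventually
    ((hy (ι (y 0))).eventually_ge_atTop (M + (3 * ε + 1)))) n
  refine ⟨max ⌈M'⌉₊ n, le_max_right _ _, j, hnj, ?_⟩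
  have hry := hM' (y 0) (r.vertex (max ⌈M'⌉₊ n)) (y j) (by
    rw [gromovProduct_eq_dist_of_mem hrj, ← hr₀, r.dist_zero]
    exact (Nat.le_ceil M').trans (by exact_mod_cast le_max_left _ _))
  exact (add_sub_cancel_right M _).ge.trans (h4.le_gromovProduct hry hyj)

theorem exists_tree_ray (hτ : TreeOfGraphs Γ T τ N δ) {σ : W → X}
    (hσ : Function.RightInverse σ τ) {s : GeodesicRay Γ}
    (hs : ∀ t, ∀ᶠ n in atTop, τ (s.vertex n) ≠ t) :
    ∃ r : GeodesicRay T, CoConvergent Γ (σ ∘ r.vertex) s.vertex := by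
  obtain ⟨ε, hε⟩ := hτ.thinIntervals
  obtain ⟨r, hr₀, hr⟩ := exists_ray_of_finite hτ.isTree.1 (τ (s.vertex 0)) (τ ∘ s.vertex)
    fun v => by
      obtain ⟨b, hb, hconst⟩ := eventually_toward_eq hτ.isTree (t := τ ∘ s.vertex)
        (fun n => hτ.adj (s.adj_succ n)) (hs v)
      refine ⟨{b}, Set.finite_singleton b, ?_⟩
      filter_upwards [hconst, hs v] with n hn hne
      exact ⟨b, rfl, hb.ne', hn ▸ (toward_spec hτ.isTree hne).2⟩
  refine ⟨r, ((hτ.isGromovProper_section hσ).isGromovSequence hτ.connected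
    (r.isGromovSequence hτ.isTree.1)).coConvergent hτ.connected
    (hε.fourPoint hτ.connected) (s.isGromovSequence hτ.connected) (s.vertex 0) fun M n => ?_⟩
  obtain ⟨C, -, hC⟩ := hτ.tree_gromovProduct_le
  obtain ⟨j, hnj, hj⟩ := frequently_atTop.1 (hr (max ⌈M + C⌉₊ n)) n
  rw [Function.comp_apply] at hj
  refine ⟨max ⌈M + C⌉₊ n, le_max_right _ _, j, hnj, ?_⟩
  have hle := hC (s.vertex 0) (σ (r.vertex (max ⌈M + C⌉₊ n))) (s.vertex j)
  rw [hσ, gromovProduct_eq_dist_of_mem hj, ← hr₀, r.dist_zero] at hle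
  have hceil : M + C ≤ (max ⌈M + C⌉₊ n : ℕ) :=
    (Nat.le_ceil _).trans (by exact_mod_cast le_max_left _ _)
  simp only [Function.comp_apply]
  linarith

end TreeOfGraphs

end Pieces
/-! ### Separating boundary points by edges of the tree -/

section Separation

section ClopenSeparated

variable {α : Type*} [TopologicalSpace α] {S S' : Set α}

/-- Some clopen set contains `S` and misses `S'`. -/
def ClopenSeparated (S S' : Set α) : Prop := ∃ O, IsClopen O ∧ S ⊆ O ∧ Disjoint S' O

lemma ClopenSeparated.symm (h : ClopenSeparated S S') : ClopenSeparated S' S := by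
  obtain ⟨O, hO, hS, hS'⟩ := h
  exact ⟨Oᶜ, hO.compl, hS'.subset_compl_right, Set.disjoint_compl_right_iff_subset.2 hS⟩

lemma ClopenSeparated.disjoint (h : ClopenSeparated S S') : Disjoint S S' := by
  obtain ⟨O, -, hS, hS'⟩ := h
  exact (hS'.mono_right hS).symm

lemma isClosed_of_clopenSeparated (h : ∀ ζ ∉ S, ∃ S', ζ ∈ S' ∧ ClopenSeparated S S') :
    IsClosed S := by
  rw [← isOpen_compl_iff, isOpen_iff_forall_mem_open]
  intro ζ hζ
  obtain ⟨S', hζS', hsep⟩ := h ζ hζ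
  obtain ⟨O, hO, hS'O, hdisj⟩ := hsep.symm
  exact ⟨O, hdisj.subset_compl_left, hO.isOpen, hS'O hζS'⟩

lemma connectedComponent_subset_of_clopenSeparated {ξ : α} (hξ : ξ ∈ S)
    (h : ∀ ζ ∉ S, ∃ S', ζ ∈ S' ∧ ClopenSeparated S S') : connectedComponent ξ ⊆ S := by
  intro ζ hζ
  by_contra hζS
  obtain ⟨S', hζS', O, hO, hSO, hdisj⟩ := h ζ hζS
  exact Set.disjoint_left.1 hdisj hζS' (hO.connectedComponent_subset (hSO hξ) hζ)

end ClopenSeparated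

variable {X W : Type*} {Γ : SimpleGraph X} {T : SimpleGraph W} {τ : X → W} {N δ : ℕ}
  {a b : W} {ρ ρ' : ℕ → W}

/-- The boundary points beyond the edge `ab`, on the side of `b`. -/
def farSide (Γ : SimpleGraph X) (T : SimpleGraph W) (τ : X → W) (a b : W) : Set (Boundary Γ) :=
  {ξ | ∃ y, ConvergesTo Γ y ξ ∧ ∀ᶠ i in atTop, toward T a (τ (y i)) = b}

/-- The boundary points before the edge `ab`, on the side of `a`. -/
def nearSide (Γ : SimpleGraph X) (T : SimpleGraph W) (τ : X → W) (a b : W) : Set (Boundary Γ) :=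
  {ξ | ∃ y, ConvergesTo Γ y ξ ∧ ∀ᶠ i in atTop, toward T a (τ (y i)) ≠ b}

/-- The boundary points that are limits of sequences over the sequence `ρ` in the tree: for
constant `ρ` those of a fibre, and for a ray `ρ` the one that belongs to the end of `ρ`. -/
def limitsOver (Γ : SimpleGraph X) (τ : X → W) (ρ : ℕ → W) : Set (Boundary Γ) :=
  {ξ | ∃ y, ConvergesTo Γ y ξ ∧ ∀ n, τ (y n) = ρ n}

lemma limitsOver_subset_farSide (hρ : ∀ᶠ n in atTop, toward T a (ρ n) = b) :
    limitsOver Γ τ ρ ⊆ farSide Γ T τ a b := by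
  rintro ξ ⟨y, hy, hyρ⟩
  exact ⟨y, hy, by simpa only [hyρ] using hρ⟩

lemma limitsOver_subset_nearSide (hρ : ∀ᶠ n in atTop, toward T a (ρ n) ≠ b) :
    limitsOver Γ τ ρ ⊆ nearSide Γ T τ a b := by
  rintro ξ ⟨y, hy, hyρ⟩
  exact ⟨y, hy, by simpa only [hyρ] using hρ⟩

namespace TreeOfGraphs

lemma exists_not_near (hτ : TreeOfGraphs Γ T τ N δ) (hab : T.Adj a b) (o : X) :
    ∃ n, ∀ ξ ∈ nearSide Γ T τ a b, ∀ ξ' ∈ farSide Γ T τ a b,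
      ¬Near Γ o n ξ ξ' ∧ ¬Near Γ o n ξ' ξ := by
  obtain ⟨ε, hε⟩ := hτ.thinIntervals
  have h4 := hε.fourPoint hτ.connected
  obtain ⟨C, hC⟩ := hτ.exists_gromovProduct_le hab o
  have hceil := Nat.le_ceil (C + 2 * (3 * ε + 1) + 1)
  refine ⟨⌈C + 2 * (3 * ε + 1) + 1⌉₊, fun ξ ⟨y, hy, hnear⟩ ξ' ⟨y', hy', hfar⟩ => ?_⟩
  obtain ⟨s, rfl⟩ := exists_point_eq ξ
  obtain ⟨s', rfl⟩ := exists_point_eq ξ'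
  rw [convergesTo_iff hτ.connected hε] at hy hy'
  constructor <;> intro h
  · obtain ⟨i, hle, hi, hi'⟩ :=
      ((h.eventually_le hτ.connected h4 hy hy').and (hnear.and hfar)).exists
    linarith [hC _ _ hi hi']
  · obtain ⟨i, hle, hi, hi'⟩ :=
      ((h.eventually_le hτ.connected h4 hy' hy).and (hnear.and hfar)).exists
    rw [gromovProduct_comm] at hle
    linarith [hC _ _ hi hi']

lemma mem_nearSide_or_mem_farSide (hτ : TreeOfGraphs Γ T τ N δ) (hab : T.Adj a b)
    (ξ : Boundary Γ) : ξ ∈ nearSide Γ T τ a b ∨ ξ ∈ farSide Γ T τ a b := by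
  obtain ⟨ε, hε⟩ := hτ.thinIntervals
  obtain ⟨s, rfl⟩ := exists_point_eq ξ
  have hs := s.convergesTo_point hτ.connected hε
  by_contra! h
  have hfar : ∃ᶠ i in atTop, toward T a (τ (s.vertex i)) = b := fun h' => h.1 ⟨_, hs, h'⟩
  have hnear : ∃ᶠ i in atTop, toward T a (τ (s.vertex i)) ≠ b := fun h' =>
    h.2 ⟨_, hs, h'.mono fun _ => not_not.1⟩
  obtain ⟨C, hC⟩ := hτ.exists_gromovProduct_le hab (s.vertex 0)
  obtain ⟨n, hn⟩ := (s.isGromovSequence hτ.connected).exists_forall_ge (s.vertex 0) (C + 1)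
  obtain ⟨i, hni, hi⟩ := frequently_atTop.1 hfar n
  obtain ⟨j, hnj, hj⟩ := frequently_atTop.1 hnear n
  linarith [hC _ _ hj hi, hn j hnj i hni]

lemma disjoint_nearSide_farSide (hτ : TreeOfGraphs Γ T τ N δ) (hab : T.Adj a b) :
    Disjoint (nearSide Γ T τ a b) (farSide Γ T τ a b) := by
  obtain ⟨o⟩ := hτ.connected.nonempty
  obtain ⟨n, hn⟩ := hτ.exists_not_near hab o
  exact Set.disjoint_left.2 fun ξ hnear hfar =>
    (hn ξ hnear ξ hfar).1 (near_self hτ.connected o n ξ)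

theorem isClopen_farSide (hτ : TreeOfGraphs Γ T τ N δ) (hab : T.Adj a b) :
    IsClopen (farSide Γ T τ a b) := by
  constructor
  · rw [← isOpen_compl_iff, isOpen_boundary_iff]
    intro ξ hξ o
    obtain ⟨n, hn⟩ := hτ.exists_not_near hab o
    have hξ := (hτ.mem_nearSide_or_mem_farSide hab ξ).resolve_right hξ
    exact ⟨n, fun η hnear hη => (hn ξ hξ η hη).1 hnear⟩
  · rw [isOpen_boundary_iff]
    intro ξ hξ o
    obtain ⟨n, hn⟩ := hτ.exists_not_near hab o
    exact ⟨n, fun η hnear => (hτ.mem_nearSide_or_mem_farSide hab η).resolve_left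
      fun hη => (hn η hη ξ hξ).2 hnear⟩

theorem clopenSeparated_limitsOver (hτ : TreeOfGraphs Γ T τ N δ) (hab : T.Adj a b)
    (hρ : ∀ᶠ n in atTop, toward T a (ρ n) = b) (hρ' : ∀ᶠ n in atTop, toward T a (ρ' n) ≠ b) :
    ClopenSeparated (limitsOver Γ τ ρ) (limitsOver Γ τ ρ') :=
  ⟨farSide Γ T τ a b, hτ.isClopen_farSide hab, limitsOver_subset_farSide hρ,
    (hτ.disjoint_nearSide_farSide hab).mono_left (limitsOver_subset_nearSide hρ')⟩

theorem clopenSeparated_limitsOver_const (hτ : TreeOfGraphs Γ T τ N δ) {t t' : W} (h : t ≠ t') :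
    ClopenSeparated (limitsOver Γ τ fun _ => t) (limitsOver Γ τ fun _ => t') := by
  have hadj := (toward_spec hτ.isTree h).1
  exact hτ.clopenSeparated_limitsOver hadj (.of_forall fun _ => rfl)
    (.of_forall fun _ => (toward_self hτ.isTree t').trans_ne hadj.ne)

theorem clopenSeparated_limitsOver_ray_const (hτ : TreeOfGraphs Γ T τ N δ) (r : GeodesicRay T)
    (t : W) : ClopenSeparated (limitsOver Γ τ r.vertex) (limitsOver Γ τ fun _ => t) := by
  obtain ⟨b, hadj, hb⟩ := r.eventually_toward_eq hτ.isTree t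
  exact hτ.clopenSeparated_limitsOver hadj hb
    (.of_forall fun _ => (toward_self hτ.isTree t).trans_ne hadj.ne)

theorem clopenSeparated_limitsOver_ray (hτ : TreeOfGraphs Γ T τ N δ) {r r' : GeodesicRay T}
    (h : r.point ≠ r'.point) :
    ClopenSeparated (limitsOver Γ τ r.vertex) (limitsOver Γ τ r'.vertex) := by
  rw [Ne, GeodesicRay.point_eq_iff hτ.isTree.1 (fourPoint_of_isTree hτ.isTree)] at h
  obtain ⟨m, hm⟩ := exists_eventually_toward_ne hτ.isTree h
  exact hτ.clopenSeparated_limitsOver (r.adj_succ m)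
    ((eventually_gt_atTop m).mono fun n hn => r.toward_vertex hτ.isTree hn) hm

end TreeOfGraphs

end Separation

/-! ### The boundary of a tree of graphs -/

section TreeBoundary

theorem connectedComponent_eq_image {α β : Type*} [TopologicalSpace α] [TopologicalSpace β]
    {F : α → β} (hF : Topology.IsClosedEmbedding F) (η : α)
    (hsub : connectedComponent (F η) ⊆ Set.range F) :
    connectedComponent (F η) = F '' connectedComponent η := by
  have himage : F '' (F ⁻¹' connectedComponent (F η)) = connectedComponent (F η) :=
    Set.image_preimage_eq_of_subset hsub
  refine subset_antisymm ?_ (hF.continuous.image_connectedComponent_subset η)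
  have hpre : IsPreconnected (F ⁻¹' connectedComponent (F η)) := by
    rw [← hF.isInducing.isPreconnected_image, himage]
    exact isPreconnected_connectedComponent
  rw [← himage]
  exact Set.image_mono (hpre.subset_connectedComponent mem_connectedComponent)

variable {X Y W : Type*} {Γ : SimpleGraph X} {Δ : SimpleGraph Y} {T : SimpleGraph W} {τ : X → W}
  {N δ ε : ℕ} {t : W} {ι : Δ ↪g Γ} {σ : W → X}

lemma IsPiece.mem_limitsOver (hι : IsPiece τ t ι) (hΔ : Δ.Connected) (hε : ThinIntervals Δ ε)
    {F : Boundary Δ → Boundary Γ} (hF : Induces ι F) (η : Boundary Δ) :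
    F η ∈ limitsOver Γ τ fun _ => t := by
  obtain ⟨r, rfl⟩ := exists_point_eq η
  exact ⟨_, hF _ _ (r.convergesTo_point hΔ hε), fun _ => hι.apply_eq _⟩

namespace TreeOfGraphs

theorem exists_induces_piece (hτ : TreeOfGraphs Γ T τ N δ) (hι : IsPiece τ t ι)
    (hΔ : Δ.Connected) (hε : ThinIntervals Δ ε) :
    ∃ F : Boundary Δ → Boundary Γ, Induces ι F := by
  obtain ⟨δ', hδ'⟩ := hτ.thinIntervals
  have hproper := hτ.isGromovProper_piece hι hΔ
  exact hproper.exists_induces hτ.connected hΔ hδ' hε fun r => hτ.exists_ray_of_fibre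
    (hproper.isGromovSequence hτ.connected (r.isGromovSequence hΔ)) fun _ => hι.apply_eq _

theorem exists_induces_section (hτ : TreeOfGraphs Γ T τ N δ)
    (hσ : Function.RightInverse σ τ) : ∃ F : Boundary T → Boundary Γ, Induces σ F := by
  obtain ⟨δ', hδ'⟩ := hτ.thinIntervals
  have hproper := hτ.isGromovProper_section hσ
  exact hproper.exists_induces hτ.connected hτ.isTree.1 hδ' (thinIntervals_of_isTree hτ.isTree)
    fun r => hτ.exists_ray_of_tree_ray (hproper.isGromovSequence hτ.connected
      (r.isGromovSequence hτ.isTree.1)) r fun _ => hσ _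

theorem convergesTo_of_tree_convergesTo (hτ : TreeOfGraphs Γ T τ N δ)
    (hσ : Function.RightInverse σ τ) {F : Boundary T → Boundary Γ} (hF : Induces σ F)
    {z : ℕ → X} {η : Boundary T} (hz : ConvergesTo T (τ ∘ z) η) : ConvergesTo Γ z (F η) := by
  obtain ⟨ε, hε⟩ := hτ.thinIntervals
  obtain ⟨o⟩ := hτ.connected.nonempty
  obtain ⟨C, -, hC⟩ := hτ.tree_gromovProduct_le
  obtain ⟨r, rfl⟩ := exists_point_eq η
  obtain ⟨s, hs⟩ := exists_point_eq (F r.point)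
  have hTthin := thinIntervals_of_isTree hτ.isTree
  rw [convergesTo_iff hτ.isTree.1 hTthin] at hz
  have hzr : CoConvergent Γ z (σ ∘ r.vertex) := by
    refine .of_base hτ.connected o (tendsto_atTop_mono (fun i => ?_)
      (tendsto_atTop_add_const_right _ (-C) (hz (τ o))))
    have hle := hC o (z i) (σ (r.vertex i))
    rw [hσ] at hle
    simp only [Function.comp_apply]
    linarith
  rw [← hs, convergesTo_iff hτ.connected hε]
  exact hzr.trans (hε.fourPoint hτ.connected)
    (hF.coConvergent hτ.connected hτ.isTree.1 hε hTthin hs)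

lemma exists_mem_limitsOver (hτ : TreeOfGraphs Γ T τ N δ) (ξ : Boundary Γ) :
    (∃ t, ξ ∈ limitsOver Γ τ fun _ => t) ∨ ∃ r : GeodesicRay T, ξ ∈ limitsOver Γ τ r.vertex := by
  obtain ⟨ε, hε⟩ := hτ.thinIntervals
  obtain ⟨s, rfl⟩ := exists_point_eq ξ
  by_cases hs : ∀ t, ∀ᶠ n in atTop, τ (s.vertex n) ≠ t
  · obtain ⟨σ, hσ⟩ := hτ.surjective.hasRightInverse
    obtain ⟨r, hr⟩ := hτ.exists_tree_ray hσ hs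
    exact .inr ⟨r, _, (convergesTo_iff hτ.connected hε).2 hr, fun _ => hσ _⟩
  · push Not at hs
    obtain ⟨t, ht⟩ := hs
    obtain ⟨φ, hφ, hφt⟩ := extraction_of_frequently_atTop ht
    exact .inl ⟨t, s.vertex ∘ φ, (convergesTo_iff hτ.connected hε).2
      ((s.isGromovSequence hτ.connected).coConvergent_comp hφ.tendsto_atTop), hφt⟩

theorem range_piece (hτ : TreeOfGraphs Γ T τ N δ) (hι : IsPiece τ t ι) (hΔ : Δ.Connected)
    (hε : ThinIntervals Δ ε) (hfin : IsLocallyFinite Δ) {F : Boundary Δ → Boundary Γ}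
    (hF : Induces ι F) : Set.range F = limitsOver Γ τ fun _ => t := by
  refine subset_antisymm (Set.range_subset_iff.2 (hι.mem_limitsOver hΔ hε hF)) ?_
  obtain ⟨δ', hδ'⟩ := hτ.thinIntervals
  rintro ξ ⟨y, hy, hyt⟩
  obtain ⟨s, rfl⟩ := exists_point_eq ξ
  choose a ha using fun n => hι.exists_apply_eq (hyt n)
  obtain rfl : ι ∘ a = y := funext ha
  obtain ⟨r, hr⟩ := hτ.exists_piece_ray hι hΔ hfin ((convergesTo_iff hτ.connected hδ').1 hy)
  exact ⟨r.point, (hF _ _ (r.convergesTo_point hΔ hε)).unique hτ.connected hδ'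
    ((convergesTo_iff hτ.connected hδ').2 hr)⟩

theorem limitsOver_ray (hτ : TreeOfGraphs Γ T τ N δ) (hσ : Function.RightInverse σ τ)
    {F : Boundary T → Boundary Γ} (hF : Induces σ F) (r : GeodesicRay T) :
    limitsOver Γ τ r.vertex = {F r.point} := by
  obtain ⟨ε, hε⟩ := hτ.thinIntervals
  have hr := r.convergesTo_point hτ.isTree.1 (thinIntervals_of_isTree hτ.isTree)
  refine subset_antisymm ?_ (Set.singleton_subset_iff.2 ⟨_, hF _ _ hr, fun _ => hσ _⟩)
  rintro ξ ⟨y, hy, hyr⟩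
  obtain hyr : τ ∘ y = r.vertex := funext hyr
  exact hy.unique hτ.connected hε (hτ.convergesTo_of_tree_convergesTo hσ hF (hyr ▸ hr))

theorem injective_piece (hτ : TreeOfGraphs Γ T τ N δ) (hι : IsPiece τ t ι) (hΔ : Δ.Connected)
    (hε : ThinIntervals Δ ε) {F : Boundary Δ → Boundary Γ} (hF : Induces ι F) :
    Function.Injective F := by
  obtain ⟨δ', hδ'⟩ := hτ.thinIntervals
  obtain ⟨C, hC⟩ := hτ.gromovProduct_piece_le hι hΔ hε
  exact hF.injective hC hτ.connected hΔ hδ' hε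

lemma eq_of_mem_limitsOver_const (hτ : TreeOfGraphs Γ T τ N δ) {t' : W} {ξ : Boundary Γ}
    (h : ξ ∈ limitsOver Γ τ fun _ => t) (h' : ξ ∈ limitsOver Γ τ fun _ => t') : t = t' := by
  by_contra hne
  exact Set.disjoint_left.1 (hτ.clopenSeparated_limitsOver_const hne).disjoint h h'

lemma section_notMem_limitsOver_const (hτ : TreeOfGraphs Γ T τ N δ)
    (hσ : Function.RightInverse σ τ) {F : Boundary T → Boundary Γ} (hF : Induces σ F)
    (η : Boundary T) (t : W) : F η ∉ limitsOver Γ τ fun _ => t := by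
  obtain ⟨r, rfl⟩ := exists_point_eq η
  exact Set.disjoint_left.1 (hτ.clopenSeparated_limitsOver_ray_const r t).disjoint
    (hτ.limitsOver_ray hσ hF r ▸ rfl)

theorem injective_pieces (hτ : TreeOfGraphs Γ T τ N δ) {I : Type*} {t : I → W}
    (ht : Function.Injective t) {ι : I → Δ ↪g Γ} (hι : ∀ i, IsPiece τ (t i) (ι i))
    (hΔ : Δ.Connected) (hε : ThinIntervals Δ ε) {F : I → Boundary Δ → Boundary Γ}
    (hF : ∀ i, Induces (ι i) (F i)) :
    Function.Injective fun z : I × Boundary Δ => F z.1 z.2 := by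
  rintro ⟨i, η⟩ ⟨j, η'⟩ (h : F i η = F j η')
  obtain rfl := ht (hτ.eq_of_mem_limitsOver_const ((hι i).mem_limitsOver hΔ hε (hF i) η)
    (h ▸ (hι j).mem_limitsOver hΔ hε (hF j) η'))
  rw [hτ.injective_piece (hι i) hΔ hε (hF i) h]

theorem injective_section (hτ : TreeOfGraphs Γ T τ N δ) (hσ : Function.RightInverse σ τ)
    {F : Boundary T → Boundary Γ} (hF : Induces σ F) : Function.Injective F := by
  intro η η' h
  obtain ⟨r, rfl⟩ := exists_point_eq η
  obtain ⟨r', rfl⟩ := exists_point_eq η'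
  by_contra hne
  have hdisj := (hτ.clopenSeparated_limitsOver_ray hne).disjoint
  rw [hτ.limitsOver_ray hσ hF, hτ.limitsOver_ray hσ hF, h] at hdisj
  exact Set.disjoint_left.1 hdisj rfl rfl

theorem connectedComponent_piece (hτ : TreeOfGraphs Γ T τ N δ) (hι : IsPiece τ t ι)
    (hΔ : Δ.Connected) (hε : ThinIntervals Δ ε) (hfin : IsLocallyFinite Δ)
    {F : Boundary Δ → Boundary Γ} (hF : Induces ι F) (η : Boundary Δ) :
    connectedComponent (F η) = F '' connectedComponent η := by
  obtain ⟨δ', hδ'⟩ := hτ.thinIntervals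
  obtain ⟨C, hC⟩ := hτ.gromovProduct_piece_le hι hΔ hε
  have hinj := hτ.injective_piece hι hΔ hε hF
  have hsep : ∀ ξ ∉ Set.range F, ∃ S, ξ ∈ S ∧ ClopenSeparated (Set.range F) S := by
    intro ξ hξ
    rw [hτ.range_piece hι hΔ hε hfin hF] at hξ ⊢
    obtain ⟨t', ht'⟩ | ⟨r, hr⟩ := hτ.exists_mem_limitsOver ξ
    · refine ⟨_, ht', hτ.clopenSeparated_limitsOver_const ?_⟩
      rintro rfl
      exact hξ ht'
    · exact ⟨_, hr, (hτ.clopenSeparated_limitsOver_ray_const r t).symm⟩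
  have hclosed := hF.isClosedMap hC hτ.connected hΔ hδ' hε (isClosed_of_clopenSeparated hsep)
  exact connectedComponent_eq_image (.of_continuous_injective_isClosedMap
    (hF.continuous (hτ.isGromovProper_piece hι hΔ) hτ.connected hΔ hδ' hε)
    hinj hclosed) η
    (connectedComponent_subset_of_clopenSeparated ⟨η, rfl⟩ hsep)

theorem connectedComponent_section (hτ : TreeOfGraphs Γ T τ N δ)
    (hσ : Function.RightInverse σ τ) {F : Boundary T → Boundary Γ} (hF : Induces σ F)
    (η : Boundary T) : connectedComponent (F η) = F '' connectedComponent η := by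
  obtain ⟨ε, hε⟩ := hτ.thinIntervals
  obtain ⟨r, rfl⟩ := exists_point_eq η
  have hsingleton : connectedComponent (F r.point) ⊆ {F r.point} := by
    refine connectedComponent_subset_of_clopenSeparated rfl fun ξ hξ => ?_
    rw [← hτ.limitsOver_ray hσ hF]
    obtain ⟨t, ht⟩ | ⟨r', hr'⟩ := hτ.exists_mem_limitsOver ξ
    · exact ⟨_, ht, hτ.clopenSeparated_limitsOver_ray_const r t⟩
    · refine ⟨_, hr', hτ.clopenSeparated_limitsOver_ray fun h => hξ ?_⟩
      rwa [h, ← hτ.limitsOver_ray hσ hF]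
  have hcont := hF.continuous (hτ.isGromovProper_section hσ) hτ.connected hτ.isTree.1 hε
    (thinIntervals_of_isTree hτ.isTree)
  exact subset_antisymm
    (hsingleton.trans (Set.singleton_subset_iff.2 ⟨_, mem_connectedComponent, rfl⟩))
    (hcont.image_connectedComponent_subset _)

end TreeOfGraphs

end TreeBoundary

/-! ### Tree amalgamations -/

section Amalgamation

variable {A B W : Type*} {G : SimpleGraph A} {H : SimpleGraph B} {T : SimpleGraph W} {U V : Set W}
  {p q : ℕ∞} {N δ ε : ℕ}

namespace Gluing

/-- The copy `G^u` of `G` in `G +_T H`. -/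
def leftPiece (D : Gluing A B T U V p q) (G : SimpleGraph A) (H : SimpleGraph B) (u : U) :
    G ↪g D.sumGraph G H where
  toFun a := .inl (u, a)
  inj' _ _ h := congrArg Prod.snd (Sum.inl_injective h)
  map_rel_iff' := and_iff_right rfl

/-- The copy `H^v` of `H` in `G +_T H`. -/
def rightPiece (D : Gluing A B T U V p q) (G : SimpleGraph A) (H : SimpleGraph B) (v : V) :
    H ↪g D.sumGraph G H where
  toFun b := .inr (v, b)
  inj' _ _ h := congrArg Prod.snd (Sum.inr_injective h)
  map_rel_iff' := and_iff_right rfl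

variable (D : Gluing A B T U V p q)

variable (G H) in
lemma isPiece_left (hUV : Disjoint U V) (u : U) :
    IsPiece treeVertex (u : W) (D.leftPiece G H u) := by
  ext (⟨u', a⟩ | ⟨v, b⟩)
  · refine ⟨fun ⟨_, h⟩ => h ▸ rfl, fun h => ?_⟩
    obtain rfl : u' = u := Subtype.ext h
    exact ⟨a, rfl⟩
  · exact ⟨fun ⟨_, h⟩ => h ▸ rfl, fun h => (hUV.ne_of_mem u.2 v.2 h.symm).elim⟩

variable (G H) in
lemma isPiece_right (hUV : Disjoint U V) (v : V) :
    IsPiece treeVertex (v : W) (D.rightPiece G H v) := by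
  ext (⟨u, a⟩ | ⟨v', b⟩)
  · exact ⟨fun ⟨_, h⟩ => h ▸ rfl, fun h => (hUV.ne_of_mem u.2 v.2 h).elim⟩
  · refine ⟨fun ⟨_, h⟩ => h ▸ rfl, fun h => ?_⟩
    obtain rfl : v' = v := Subtype.ext h
    exact ⟨b, rfl⟩

variable (G H) in
lemma exists_isPiece (hUV : Disjoint U V) (hcover : U ∪ V = Set.univ) (t : W) :
    (∃ ι : G ↪g D.sumGraph G H, IsPiece treeVertex t ι) ∨
      ∃ ι : H ↪g D.sumGraph G H, IsPiece treeVertex t ι := by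
  obtain ht | ht : t ∈ U ∪ V := hcover ▸ Set.mem_univ t
  · exact .inl ⟨_, D.isPiece_left G H hUV ⟨t, ht⟩⟩
  · exact .inr ⟨_, D.isPiece_right G H hUV ⟨t, ht⟩⟩

lemma treeVertex_eq_or_adj {x y : Vertex A B U V} (h : (D.sumGraph G H).Adj x y) :
    treeVertex x = treeVertex y ∨ T.Adj (treeVertex x) (treeVertex y) := by
  rcases x with ⟨u, x⟩ | ⟨v, x⟩ <;> rcases y with ⟨u', y⟩ | ⟨v', y⟩
  · exact .inl (congrArg Subtype.val h.1)
  · exact .inr h.choose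
  · exact .inr h.choose.symm
  · exact .inl (congrArg Subtype.val h.1)

lemma exists_newEdge {u : U} {v : V} (h : T.Adj u v) : ∃ x y, D.NewEdge u x v y := by
  obtain ⟨x, hx⟩ := D.nonempty_left (D.label ⟨s((u : W), (v : W)), h⟩).1
  exact ⟨x, _, h, hx, rfl⟩

lemma exists_sumGraph_adj (hbip : T.IsBipartiteWith U V) {a b : W} (hab : T.Adj a b) :
    ∃ x y, treeVertex x = a ∧ treeVertex y = b ∧ (D.sumGraph G H).Adj x y := by
  obtain ⟨ha, hb⟩ | ⟨ha, hb⟩ := hbip.mem_of_adj hab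
  · obtain ⟨x, y, h⟩ := D.exists_newEdge (u := ⟨a, ha⟩) (v := ⟨b, hb⟩) hab
    exact ⟨.inl (⟨a, ha⟩, x), .inr (⟨b, hb⟩, y), rfl, rfl, h⟩
  · obtain ⟨x, y, h⟩ := D.exists_newEdge (u := ⟨b, hb⟩) (v := ⟨a, ha⟩) hab.symm
    exact ⟨.inr (⟨a, ha⟩, y), .inl (⟨b, hb⟩, x), rfl, rfl, h⟩

lemma fibre_dist_adhesion_le (hUV : Disjoint U V) (hG : G.Connected) (hH : H.Connected)
    (hGN : ∀ k, ∀ x ∈ D.adhesionLeft k, ∀ y ∈ D.adhesionLeft k, G.dist x y ≤ N)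
    (hHN : ∀ l, ∀ x ∈ D.adhesionRight l, ∀ y ∈ D.adhesionRight l, H.dist x y ≤ N)
    {x y x' y' : Vertex A B U V} (hxy : (D.sumGraph G H).Adj x y)
    (hxy' : (D.sumGraph G H).Adj x' y') (hx : treeVertex x = treeVertex x')
    (hy : treeVertex y = treeVertex y') (hne : treeVertex x ≠ treeVertex y) :
    (fibreGraph (D.sumGraph G H) treeVertex).dist x x' ≤ N := by
  rcases x with ⟨u, x⟩ | ⟨v, x⟩ <;> rcases y with ⟨u₁, y⟩ | ⟨v₁, y⟩
  · exact absurd (congrArg Subtype.val hxy.1) hne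
  · have hu := D.isPiece_left G H hUV u
    obtain ⟨x', rfl⟩ := hu.exists_apply_eq hx.symm
    obtain ⟨y', rfl⟩ := (D.isPiece_right G H hUV v₁).exists_apply_eq hy.symm
    obtain ⟨_, hmem, _⟩ := hxy
    obtain ⟨_, hmem', _⟩ := hxy'
    exact (hu.dist_eq hG x x').trans_le (hGN _ x hmem x' hmem')
  · have hv := D.isPiece_right G H hUV v
    obtain ⟨x', rfl⟩ := hv.exists_apply_eq hx.symm
    obtain ⟨y', rfl⟩ := (D.isPiece_left G H hUV u₁).exists_apply_eq hy.symm
    obtain ⟨-, -, rfl⟩ := hxy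
    obtain ⟨-, -, rfl⟩ := hxy'
    exact (hv.dist_eq hH _ _).trans_le (hHN _ _ (Subtype.property _) _ (Subtype.property _))
  · exact absurd (congrArg Subtype.val hxy.1) hne

theorem treeOfGraphs_sumGraph (hG : G.Connected) (hH : H.Connected)
    (hGfin : IsLocallyFinite G) (hHfin : IsLocallyFinite H) (hGδ : ThinIntervals G δ)
    (hHδ : ThinIntervals H δ) (hT : T.IsTree) (hbip : T.IsBipartiteWith U V)
    (hcover : U ∪ V = Set.univ)
    (hGN : ∀ k, ∀ x ∈ D.adhesionLeft k, ∀ y ∈ D.adhesionLeft k, G.dist x y ≤ N)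
    (hHN : ∀ l, ∀ x ∈ D.adhesionRight l, ∀ y ∈ D.adhesionRight l, H.dist x y ≤ N) :
    TreeOfGraphs (D.sumGraph G H) T treeVertex N δ where
  isTree := hT
  surjective t := by
    obtain ⟨a⟩ := hG.nonempty
    obtain ⟨b⟩ := hH.nonempty
    obtain ⟨ι, hι⟩ | ⟨ι, hι⟩ := D.exists_isPiece G H hbip.disjoint hcover t
    exacts [⟨ι a, hι.apply_eq a⟩, ⟨ι b, hι.apply_eq b⟩]
  adj := D.treeVertex_eq_or_adj
  reachable {x y} hxy := by
    obtain ⟨ι, hι⟩ | ⟨ι, hι⟩ := D.exists_isPiece G H hbip.disjoint hcover (treeVertex y)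
    exacts [hι.reachable hG hxy rfl, hι.reachable hH hxy rfl]
  exists_adj := D.exists_sumGraph_adj hbip
  adhesion := D.fibre_dist_adhesion_le hbip.disjoint hG hH hGN hHN
  thin {x y z w} hy hz hw h := by
    obtain ⟨ι, hι⟩ | ⟨ι, hι⟩ := D.exists_isPiece G H hbip.disjoint hcover (treeVertex x)
    exacts [hι.thin hG hGδ rfl hy hz hw h, hι.thin hH hHδ rfl hy hz hw h]
  finite x n := by
    obtain ⟨ι, hι⟩ | ⟨ι, hι⟩ := D.exists_isPiece G H hbip.disjoint hcover (treeVertex x)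
    exacts [hι.finite hG hGfin rfl n, hι.finite hH hHfin rfl n]

end Gluing

section BoundaryMap

variable {D : Gluing A B T U V p q} {f : PieceBoundary T U V G H → Boundary (D.sumGraph G H)}
  {σ : W → Vertex A B U V}

lemma RespectsPieces.induces_left (hf : RespectsPieces D f) (u : U) :
    Induces (D.leftPiece G H u) fun η => f (ofLeft T V H u η) :=
  hf.1 u

lemma RespectsPieces.induces_right (hf : RespectsPieces D f) (v : V) :
    Induces (D.rightPiece G H v) fun η => f (ofRight T U G v η) :=
  hf.2 v

lemma RespectsTree.induces_section (hf : RespectsTree D f)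
    (hσ : Function.RightInverse σ treeVertex) :
    Induces σ fun η => f (ofTree U V G H η) := fun x η hx =>
  hf (σ ∘ x) η (by simpa only [Function.comp_apply, hσ _] using hx)

theorem exists_respects (hτ : TreeOfGraphs (D.sumGraph G H) T treeVertex N δ)
    (hUV : Disjoint U V) (hG : G.Connected) (hH : H.Connected) (hGε : ThinIntervals G ε)
    (hHε : ThinIntervals H ε) :
    ∃ f : PieceBoundary T U V G H → Boundary (D.sumGraph G H),
      RespectsPieces D f ∧ RespectsTree D f := by
  obtain ⟨σ, hσ⟩ := hτ.surjective.hasRightInverse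
  obtain ⟨FT, hFT⟩ := hτ.exists_induces_section hσ
  choose FG hFG using fun u => hτ.exists_induces_piece (D.isPiece_left G H hUV u) hG hGε
  choose FH hFH using fun v => hτ.exists_induces_piece (D.isPiece_right G H hUV v) hH hHε
  exact ⟨Sum.elim FT (Sum.elim (fun z => FG z.1 z.2) fun z => FH z.1 z.2), ⟨hFG, hFH⟩,
    fun _ _ => hτ.convergesTo_of_tree_convergesTo hσ hFT⟩

theorem injective_of_respects (hτ : TreeOfGraphs (D.sumGraph G H) T treeVertex N δ)
    (hUV : Disjoint U V) (hG : G.Connected) (hH : H.Connected) (hGε : ThinIntervals G ε)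
    (hHε : ThinIntervals H ε) (hf : RespectsPieces D f) (hfT : RespectsTree D f) :
    Function.Injective f := by
  obtain ⟨σ, hσ⟩ := hτ.surjective.hasRightInverse
  have htree := hfT.induces_section hσ
  have hleft := D.isPiece_left G H hUV
  have hright := D.isPiece_right G H hUV
  have hmemLeft (u η) := (hleft u).mem_limitsOver hG hGε (hf.induces_left u) η
  have hmemRight (v η) := (hright v).mem_limitsOver hH hHε (hf.induces_right v) η
  have hpieces : Function.Injective (f ∘ Sum.inr) := by
    rw [← Sum.elim_comp_inl_inr (f ∘ Sum.inr)]
    refine Function.Injective.sumElim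
      (hτ.injective_pieces Subtype.val_injective hleft hG hGε hf.induces_left)
      (hτ.injective_pieces Subtype.val_injective hright hH hHε hf.induces_right) ?_
    rintro ⟨u, η⟩ ⟨v, η'⟩ h
    exact hUV.ne_of_mem u.2 v.2
      (hτ.eq_of_mem_limitsOver_const (hmemLeft u η) (h.symm.subst (hmemRight v η')))
  rw [← Sum.elim_comp_inl_inr f]
  refine Function.Injective.sumElim (hτ.injective_section hσ htree) hpieces ?_
  rintro η (⟨u, η'⟩ | ⟨v, η'⟩) h
  · exact hτ.section_notMem_limitsOver_const hσ htree η u (Set.mem_of_eq_of_mem h (hmemLeft u η'))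
  · exact hτ.section_notMem_limitsOver_const hσ htree η v (Set.mem_of_eq_of_mem h (hmemRight v η'))

theorem surjective_of_respects (hτ : TreeOfGraphs (D.sumGraph G H) T treeVertex N δ)
    (hUV : Disjoint U V) (hcover : U ∪ V = Set.univ) (hG : G.Connected) (hH : H.Connected)
    (hGε : ThinIntervals G ε) (hHε : ThinIntervals H ε) (hGfin : IsLocallyFinite G)
    (hHfin : IsLocallyFinite H) (hf : RespectsPieces D f) (hfT : RespectsTree D f) :
    Function.Surjective f := by
  obtain ⟨σ, hσ⟩ := hτ.surjective.hasRightInverse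
  intro ξ
  obtain ⟨t, hξ⟩ | ⟨r, hξ⟩ := hτ.exists_mem_limitsOver ξ
  · obtain ht | ht : t ∈ U ∪ V := hcover ▸ Set.mem_univ t
    · have hpiece := D.isPiece_left G H hUV ⟨t, ht⟩
      rw [← hτ.range_piece hpiece hG hGε hGfin (hf.induces_left _)] at hξ
      exact hξ.imp' _ fun _ => id
    · have hpiece := D.isPiece_right G H hUV ⟨t, ht⟩
      rw [← hτ.range_piece hpiece hH hHε hHfin (hf.induces_right _)] at hξ
      exact hξ.imp' _ fun _ => id
  · rw [hτ.limitsOver_ray hσ (hfT.induces_section hσ)] at hξ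
    exact ⟨_, hξ.symm⟩

lemma preimage_connectedComponent {α β γ : Type*} [TopologicalSpace α] [TopologicalSpace γ]
    {f : β → γ} {g : α → β} {η : α} (hf : Function.Injective f)
    (h : connectedComponent (f (g η)) = (fun η => f (g η)) '' connectedComponent η) :
    f ⁻¹' connectedComponent (f (g η)) = g '' connectedComponent η := by
  rw [h, ← Set.image_image, hf.preimage_image]

theorem componentsPullBack_of_respects (hτ : TreeOfGraphs (D.sumGraph G H) T treeVertex N δ)
    (hUV : Disjoint U V) (hG : G.Connected) (hH : H.Connected)
    (hGε : ThinIntervals G ε) (hHε : ThinIntervals H ε) (hGfin : IsLocallyFinite G)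
    (hHfin : IsLocallyFinite H) (hf : RespectsPieces D f) (hfT : RespectsTree D f)
    (hbij : Function.Bijective f) : ComponentsPullBack D f := by
  intro ξ
  obtain ⟨η | ⟨u, η⟩ | ⟨v, η⟩, rfl⟩ := hbij.surjective ξ
  · obtain ⟨σ, hσ⟩ := hτ.surjective.hasRightInverse
    have hcomp := hτ.connectedComponent_section hσ (hfT.induces_section hσ) η
    exact .inl ⟨η, preimage_connectedComponent hbij.injective hcomp⟩
  · have hpiece := D.isPiece_left G H hUV u
    have hcomp := hτ.connectedComponent_piece hpiece hG hGε hGfin (hf.induces_left u) η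
    exact .inr (.inl ⟨u, η, preimage_connectedComponent hbij.injective hcomp⟩)
  · have hpiece := D.isPiece_right G H hUV v
    have hcomp := hτ.connectedComponent_piece hpiece hH hHε hHfin (hf.induces_right v) η
    exact .inr (.inr ⟨v, η, preimage_connectedComponent hbij.injective hcomp⟩)

theorem eq_of_respects (hτ : TreeOfGraphs (D.sumGraph G H) T treeVertex N δ)
    (hG : G.Connected) (hH : H.Connected) (hGε : ThinIntervals G ε) (hHε : ThinIntervals H ε)
    {g : PieceBoundary T U V G H → Boundary (D.sumGraph G H)}
    (hf : RespectsPieces D f) (hfT : RespectsTree D f)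
    (hg : RespectsPieces D g) (hgT : RespectsTree D g) : g = f := by
  obtain ⟨σ, hσ⟩ := hτ.surjective.hasRightInverse
  obtain ⟨δ', hδ'⟩ := hτ.thinIntervals
  have hTree := hτ.isTree
  funext η
  obtain η | ⟨u, η⟩ | ⟨v, η⟩ := η <;> obtain ⟨r, rfl⟩ := exists_point_eq η
  · have hr := r.convergesTo_point hTree.1 (thinIntervals_of_isTree hTree)
    exact (hgT.induces_section hσ _ _ hr).unique hτ.connected hδ' (hfT.induces_section hσ _ _ hr)
  · have hr := r.convergesTo_point hG hGε
    exact (hg.1 u _ _ hr).unique hτ.connected hδ' (hf.1 u _ _ hr)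
  · have hr := r.convergesTo_point hH hHε
    exact (hg.2 v _ _ hr).unique hτ.connected hδ' (hf.2 v _ _ hr)

end BoundaryMap

end Amalgamation

end TreeAmalgam

open TreeAmalgam in
theorem mainTheorem4_general {A B W : Type*}
    (G : SimpleGraph A) (H : SimpleGraph B)
    (hGconn : G.Connected) (hHconn : H.Connected)
    (hGfin : IsLocallyFinite G) (hHfin : IsLocallyFinite H)
    (hGhyp : IsHyperbolic G) (hHhyp : IsHyperbolic H)
    (T : SimpleGraph W) (U V : Set W) (p q : ℕ∞)
    (hT : T.IsTree) (hbip : T.IsBipartiteWith U V) (hcover : U ∪ V = Set.univ)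
    (D : Gluing A B T U V p q) (hD : D.BoundedAdhesion G H) :
    (D.sumGraph G H).Connected ∧ IsHyperbolic (D.sumGraph G H) ∧
      ∃ f : PieceBoundary T U V G H → Boundary (D.sumGraph G H),
        Function.Bijective f ∧
        ComponentsPullBack D f ∧
        RespectsPieces D f ∧
        RespectsTree D f ∧
        (∀ g : PieceBoundary T U V G H → Boundary (D.sumGraph G H),
          RespectsPieces D g → RespectsTree D g → g = f) := by
  obtain ⟨N, hGN, hHN⟩ := hD
  obtain ⟨δ₁, hGδ⟩ := hGhyp.thinIntervals hGconn
  obtain ⟨δ₂, hHδ⟩ := hHhyp.thinIntervals hHconn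
  replace hGδ := hGδ.mono (le_max_left δ₁ δ₂)
  replace hHδ := hHδ.mono (le_max_right δ₁ δ₂)
  have hτ := D.treeOfGraphs_sumGraph hGconn hHconn hGfin hHfin hGδ hHδ hT hbip hcover hGN hHN
  have hUV := hbip.disjoint
  obtain ⟨δ, hδ⟩ := hτ.thinIntervals
  obtain ⟨f, hf, hfT⟩ := exists_respects hτ hUV hGconn hHconn hGδ hHδ
  have hbij : Function.Bijective f :=
    ⟨injective_of_respects hτ hUV hGconn hHconn hGδ hHδ hf hfT,
      surjective_of_respects hτ hUV hcover hGconn hHconn hGδ hHδ hGfin hHfin hf hfT⟩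
  exact ⟨hτ.connected, hδ.isHyperbolic hτ.connected, f, hbij,
    componentsPullBack_of_respects hτ hUV hGconn hHconn hGδ hHδ hGfin hHfin hf hfT hbij, hf, hfT,
    fun _ => eq_of_respects hτ hGconn hHconn hGδ hHδ hf hfT⟩

open TreeAmalgam in
theorem mainTheorem4 {A B W : Type*}
    (G : SimpleGraph A) (H : SimpleGraph B)
    (hGconn : G.Connected) (hHconn : H.Connected)
    (hGfin : IsLocallyFinite G) (hHfin : IsLocallyFinite H)
    (hGhyp : IsHyperbolic G) (hHhyp : IsHyperbolic H)
    (hGqt : IsQuasiTransitive G) (hHqt : IsQuasiTransitive H)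
    (T : SimpleGraph W) (U V : Set W) (p q : ℕ∞) (hT : IsSemiregularTree T U V p q)
    (D : Gluing A B T U V p q) (hD : D.BoundedAdhesion G H) :
    (D.sumGraph G H).Connected ∧ IsHyperbolic (D.sumGraph G H) ∧
      ∃ f : PieceBoundary T U V G H → Boundary (D.sumGraph G H),
        Function.Bijective f ∧
        ComponentsPullBack D f ∧
        RespectsPieces D f ∧
        RespectsTree D f ∧
        (∀ g : PieceBoundary T U V G H → Boundary (D.sumGraph G H),
          RespectsPieces D g → RespectsTree D g → g = f) :=
  mainTheorem4_general G H hGconn hHconn hGfin hHfin hGhyp hHhyp T U V p q hT.isTree hT.bipartite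
    hT.cover D hD
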